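/- Let $k$ be a commutative semiring (rig). A *cartesian left-$k$-linear category* is a category $\mathcal A$ with (chosen) finite products in which every hom-set is a $k$-module, each precomposition map $({-})\circ f$ is $k$-linear, and the product bijections $\mathcal A(A,B\times C)\to\mathcal A(A,B)\oplus\mathcal A(A,C)$ are $k$-linear. A *cartesian differential category* is a cartesian left-$k$-linear category with operators $\mathrm D\colon\mathcal A(A,B)\to\mathcal A(A\times A,B)$ such that: (i) $\mathrm D$ is $k$-linear; (ii) $\mathrm Df$ is $k$-linear in its second argument; (iii) $\mathrm D(\pi_i)=\pi_i\pi_1$ for $i=0,1$; (iv) $\mathrm D(1_A)=\pi_1$; (v) $\mathrm D(gf)=\mathrm Dg\,(f\pi_0,\mathrm Df)$; (vi) $\mathrm D(\mathrm Df)(x,r,0,v)=\mathrm Df(x,v)$; (vii) $\mathrm D(\mathrm Df)(x,r,s,0)=\mathrm D(\mathrm Df)(x,s,r,0)$. **Proposition.** Let $\mathcal A$ be a cartesian left-$k$-linear category. The following data form a cartesian differential category $\mathsf{Fa\grave a}(\mathcal A)$. - Objects are those of $\mathcal A$. A morphism $f^{(\bullet)}\colon A\rightsquigarrow B$ is a family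 of maps $f^{(n)}\colon A\times A^n\to B$ of $\mathcal A$ $(n\in\mathbb N)$, where each $f^{(n)}$ is symmetric and $k$-linear in each of its last $n$ variables. - Identities are given by $\mathrm{id}^{(0)}=\mathrm{id}_A$ (identifying $A\times A^0$ with $A$), $\mathrm{id}^{(1)}=\pi_1$ and $\mathrm{id}^{(n)}=0$ for $n\ge 2$. - Composition is given by the Faà di Bruno formula $$(g\circ f)^{(n)}=\sum_{[n]=A_1\mid\cdots\mid A_m} g^{(m)}\circ\bigl(f^{(\emptyset)},f^{(A_1)},\dots,f^{(A_m)}\bigr),$$ the sum being over all unordered partitions of $[n]=\{1,\dots,n\}$ into non-empty parts, where $f^{(I)}(x_0,\dots,x_n)=f^{(i)}(x_0,x_{n_1},\dots,x_{n_i})$ for $I=\{n_1<\dots<n_i\}\subseteq[n]$. - The $k$-module structure on hom-sets is componentwise. - The terminal object and the binary products of objects are those of $\mathcal A$, with projections $(\pi_i)^{(0)}=\pi_i$, $(\pi_i)^{(1)}=\pi_i\pi_1$ and $(\pi_i)^{(n)}=0$ for $n\ge2$. - The differential $\mathrm Df\colon A\times A\rightsquigarrow B$ of $f\colon A\rightsquigarrow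 B$ is given by $$(\mathrm Df)^{(n)}(x_0,y_0,\dots,x_n,y_n)=f^{(n+1)}(x_0,\dots,x_n,y_0)+\sum_{i=1}^n f^{(n)}(x_0,\dots,x_{i-1},y_i,x_{i+1},\dots,x_n).$$ -/

import Mathlib

open CategoryTheory MonoidalCategory CartesianMonoidalCategory

universe w v u

/-! ### Cartesian left-`k`-linear categories -/

/-- Commutative monoid structures on the hom-sets which are preserved by precomposition. -/
class LeftAdditiveCategory (C : Type u) [Category.{v} C] where
  homAddCommMonoid : ∀ A B : C, AddCommMonoid (A ⟶ B)
  comp_add : ∀ {A B D : C} (f : A ⟶ B) (g h : B ⟶ D), f ≫ (g + h) = f ≫ g + f ≫ h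
  comp_zero : ∀ {A B : C} (f : A ⟶ B) (D : C), f ≫ (0 : B ⟶ D) = 0

attribute [reducible, instance] LeftAdditiveCategory.homAddCommMonoid

/-- A left-`k`-linear category: every hom-set is a `k`-module, and for each `f` the function
`g ↦ g ∘ f` is `k`-linear. -/
class LeftLinearCategory (k : Type w) [CommSemiring k] (C : Type u) [Category.{v} C]
    [LeftAdditiveCategory C] where
  homModule : ∀ A B : C, Module k (A ⟶ B)
  comp_smul : ∀ {A B D : C} (f : A ⟶ B) (r : k) (g : B ⟶ D), f ≫ (r • g) = r • (f ≫ g)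

attribute [reducible, instance] LeftLinearCategory.homModule

/-- A cartesian left-`k`-linear category: the category has (chosen) finite products, and the
bijections `C(A, B × D) → C(A, B) ⊕ C(A, D)` are `k`-linear. -/
class CartesianLeftLinearCategory (k : Type w) [CommSemiring k] (C : Type u) [Category.{v} C]
    [CartesianMonoidalCategory C] [LeftAdditiveCategory C] extends LeftLinearCategory k C where
  isLinearMap_pair : ∀ A B D : C,
    IsLinearMap k (fun h : A ⟶ B ⊗ D => ((h ≫ fst B D, h ≫ snd B D) : (A ⟶ B) × (A ⟶ D)))

/-! ### Cartesian differential categories -/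

/-- A `k`-linear cartesian differential category. -/
class CartesianDifferentialCategory (k : Type w) [CommSemiring k] (C : Type u) [Category.{v} C]
    [CartesianMonoidalCategory C] [LeftAdditiveCategory C]
    extends CartesianLeftLinearCategory k C where
  /-- The differential operator. -/
  D : ∀ {A B : C}, (A ⟶ B) → (A ⊗ A ⟶ B)
  /-- `D` is `k`-linear. -/
  isLinearMap_D : ∀ A B : C, IsLinearMap k (fun f : A ⟶ B => D f)
  /-- `D f` is `k`-linear in its second argument. -/
  isLinearMap_lift_D : ∀ {A B : C} (f : A ⟶ B) {Z : C} (x : Z ⟶ A),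
    IsLinearMap k (fun v : Z ⟶ A => lift x v ≫ D f)
  D_fst : ∀ A B : C, D (fst A B) = snd (A ⊗ B) (A ⊗ B) ≫ fst A B
  D_snd : ∀ A B : C, D (snd A B) = snd (A ⊗ B) (A ⊗ B) ≫ snd A B
  D_id : ∀ A : C, D (𝟙 A) = snd A A
  D_comp : ∀ {A B E : C} (f : A ⟶ B) (g : B ⟶ E),
    D (f ≫ g) = lift (fst A A ≫ f) (D f) ≫ D g
  /-- `D (D f) (x, r, 0, v) = D f (x, v)`. -/
  D_D_zero : ∀ {A B : C} (f : A ⟶ B) {Z : C} (x r v : Z ⟶ A),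
    lift (lift x r) (lift 0 v) ≫ D (D f) = lift x v ≫ D f
  /-- `D (D f) (x, r, s, 0) = D (D f) (x, s, r, 0)`. -/
  D_D_symm : ∀ {A B : C} (f : A ⟶ B) {Z : C} (x r s : Z ⟶ A),
    lift (lift x r) (lift s 0) ≫ D (D f) = lift (lift x s) (lift r 0) ≫ D (D f)

/-- The data of a `k`-linear cartesian differential category with objects `X`, without any laws. -/
structure CartesianDifferentialData (k : Type w) (X : Type u) where
  Hom : X → X → Type v
  id : ∀ A, Hom A A
  /-- Composition in diagrammatic order. -/
  comp : ∀ {A B E}, Hom A B → Hom B E → Hom A E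
  zero : ∀ A B, Hom A B
  add : ∀ {A B}, Hom A B → Hom A B → Hom A B
  smul : ∀ {A B}, k → Hom A B → Hom A B
  /-- The terminal object. -/
  one : X
  /-- The binary product of objects. -/
  prod : X → X → X
  fst : ∀ A B, Hom (prod A B) A
  snd : ∀ A B, Hom (prod A B) B
  D : ∀ {A B}, Hom A B → Hom (prod A A) B

/-- The data underlying a cartesian differential category. -/
def CartesianDifferentialCategory.data (k : Type w) [CommSemiring k] (C : Type u)
    [Category.{v} C] [CartesianMonoidalCategory C] [LeftAdditiveCategory C]
    [CartesianDifferentialCategory k C] : CartesianDifferentialData.{w, v, u} k C where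
  Hom A B := A ⟶ B
  id A := 𝟙 A
  comp f g := f ≫ g
  zero _ _ := 0
  add f g := f + g
  smul r f := r • f
  one := 𝟙_ C
  prod A B := A ⊗ B
  fst A B := CartesianMonoidalCategory.fst A B
  snd A B := CartesianMonoidalCategory.snd A B
  D f := CartesianDifferentialCategory.D k f

/-! ### Powers -/

namespace Faa

section Powers

variable {C : Type u} [Category.{v} C] [CartesianMonoidalCategory C]

/-- The power `A ^ n`. -/
def pow (A : C) : ℕ → C
  | 0 => 𝟙_ C
  | n + 1 => A ⊗ pow A n

/-- The projections `A ^ n ⟶ A`. -/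
def proj (A : C) : ∀ {n : ℕ}, Fin n → (pow A n ⟶ A)
  | 0, i => i.elim0
  | n + 1, i => Fin.cases (fst A (pow A n)) (fun j => snd A (pow A n) ≫ proj A j) i

/-- The map `(v 0, …, v (n - 1)) : X ⟶ A ^ n`. -/
def tuple {A X : C} : ∀ {n : ℕ}, (Fin n → (X ⟶ A)) → (X ⟶ pow A n)
  | 0, _ => toUnit X
  | _ + 1, v => lift (v 0) (tuple fun j => v j.succ)

theorem tuple_proj {A X : C} {n : ℕ} (v : Fin n → (X ⟶ A)) (i : Fin n) :
    tuple v ≫ proj A i = v i := by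
  induction n with
  | zero => exact i.elim0
  | succ n ih =>
    refine Fin.cases ?_ (fun j => ?_) i
    · exact lift_fst (v 0) (tuple fun j => v j.succ)
    · exact (lift_snd_assoc (v 0) (tuple fun j => v j.succ) (proj A j)).trans (ih _ j)

theorem comp_tuple {A X Y : C} {n : ℕ} (u : Y ⟶ X) (v : Fin n → (X ⟶ A)) :
    u ≫ tuple v = tuple fun i => u ≫ v i := by
  induction n with
  | zero => exact toUnit_unique _ _
  | succ n ih => exact (comp_lift _ _ _).trans (congrArg _ (ih _))

/-- `f (x, v 0, …, v (n - 1))` for `f : A × A ^ n ⟶ B` and generalised elements `x`, `v i`. -/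
def ap {A B X : C} {n : ℕ} (f : A ⊗ pow A n ⟶ B) (x : X ⟶ A) (v : Fin n → (X ⟶ A)) : X ⟶ B :=
  lift x (tuple v) ≫ f

theorem comp_ap {A B X Y : C} {n : ℕ} (u : Y ⟶ X) (f : A ⊗ pow A n ⟶ B) (x : X ⟶ A)
    (v : Fin n → (X ⟶ A)) : u ≫ ap f x v = ap f (u ≫ x) fun i => u ≫ v i := by
  simp [ap, ← comp_tuple, ← Category.assoc]

/-- The variable `x₀`, as a map `A × A ^ n ⟶ A`. -/
def var0 (A : C) (n : ℕ) : A ⊗ pow A n ⟶ A := fst A (pow A n)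

/-- The variables `x₁, …, xₙ` (indexed from `0`), as maps `A × A ^ n ⟶ A`. -/
def var (A : C) (n : ℕ) (i : Fin n) : A ⊗ pow A n ⟶ A := snd A (pow A n) ≫ proj A i

theorem lift_tuple_var0 {A X : C} {n : ℕ} (x : X ⟶ A) (v : Fin n → (X ⟶ A)) :
    lift x (tuple v) ≫ var0 A n = x := by
  simp [var0]

theorem lift_tuple_var {A X : C} {n : ℕ} (x : X ⟶ A) (v : Fin n → (X ⟶ A)) (i : Fin n) :
    lift x (tuple v) ≫ var A n i = v i := by
  simp [var, tuple_proj]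

end Powers

section Morphisms

variable {C : Type u} [Category.{v} C] [CartesianMonoidalCategory C]

/-- `f : A × A ^ n ⟶ B` is symmetric in its last `n` variables. -/
def IsSymmetric {A B : C} {n : ℕ} (f : A ⊗ pow A n ⟶ B) : Prop :=
  ∀ {X : C} (x : X ⟶ A) (v : Fin n → (X ⟶ A)) (σ : Equiv.Perm (Fin n)),
    ap f x (v ∘ σ) = ap f x v

variable [LeftAdditiveCategory C]

/-- `f : A × A ^ n ⟶ B` is `k`-linear in each of its last `n` variables. -/
def IsMultilinear (k : Type w) [CommSemiring k] [LeftLinearCategory k C] {A B : C} {n : ℕ}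
    (f : A ⊗ pow A n ⟶ B) : Prop :=
  ∀ {X : C} (x : X ⟶ A) (v : Fin n → (X ⟶ A)) (i : Fin n),
    IsLinearMap k (fun y : X ⟶ A => ap f x (Function.update v i y))

/-- A morphism `A ⇝ B` of the Faà di Bruno category. -/
@[ext]
structure Hom (k : Type w) [CommSemiring k] [LeftLinearCategory k C] (A B : C) where
  /-- The components `f⁽ⁿ⁾ : A × A ^ n ⟶ B`. -/
  map : ∀ n : ℕ, A ⊗ pow A n ⟶ B
  symm : ∀ n, IsSymmetric (map n)
  linear : ∀ n, IsMultilinear k (map n)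

end Morphisms

section Formulas

variable {C : Type u} [Category.{v} C] [CartesianMonoidalCategory C] [LeftAdditiveCategory C]

/-- The components of the family which is `p x₀` in degree `0`, `p x₁` in degree `1`, and zero in
all higher degrees. For `p = 𝟙 A` these are the components of the identity, and for `p` a product
projection those of the projection. -/
def strictMap {A B : C} (p : A ⟶ B) : ∀ n : ℕ, A ⊗ pow A n ⟶ B
  | 0 => var0 A 0 ≫ p
  | 1 => var A 1 0 ≫ p
  | _ + 2 => 0

/-- For `I = {n₁ < … < nᵢ}` a set of indices, the map `f⁽ᴵ⁾ : A × A ^ n ⟶ B` given by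
`f⁽ᴵ⁾ (x₀, …, xₙ) = f⁽ⁱ⁾ (x₀, x_{n₁}, …, x_{nᵢ})`. -/
def subsetMap {A B : C} (f : ∀ n : ℕ, A ⊗ pow A n ⟶ B) {n : ℕ} (I : Finset (Fin n)) :
    A ⊗ pow A n ⟶ B :=
  ap (f I.card) (var0 A n) (fun j => var A n (I.orderEmbOfFin rfl j))

/-- The summand `g⁽ᵏ⁾ ∘ (f⁽∅⁾, f⁽ᴬ¹⁾, …, f⁽ᴬᵏ⁾)` indexed by a partition `A₁ | … | Aₖ`. (The parts
are listed in some order; as `g⁽ᵏ⁾` will be symmetric, the order is irrelevant.) -/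
noncomputable def partitionTerm {A B E : C} (f : ∀ n : ℕ, A ⊗ pow A n ⟶ B)
    (g : ∀ n : ℕ, B ⊗ pow B n ⟶ E) {n : ℕ} (P : Finpartition (Finset.univ : Finset (Fin n))) :
    A ⊗ pow A n ⟶ E :=
  ap (g P.parts.card) (subsetMap f (∅ : Finset (Fin n)))
    (fun j => subsetMap f (P.parts.equivFin.symm j : Finset (Fin n)))

/-- The Faà di Bruno formula: the sum over all partitions of the set of indices of
`g⁽ᵏ⁾ ∘ (f⁽∅⁾, f⁽ᴬ¹⁾, …, f⁽ᴬᵏ⁾)`. -/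
noncomputable def compMap {A B E : C} (f : ∀ n : ℕ, A ⊗ pow A n ⟶ B)
    (g : ∀ n : ℕ, B ⊗ pow B n ⟶ E) (n : ℕ) : A ⊗ pow A n ⟶ E :=
  ∑ P : Finpartition (Finset.univ : Finset (Fin n)), partitionTerm f g P

/-- The components `(D f)⁽ⁿ⁾ : (A × A) × (A × A) ^ n ⟶ B`, which send `(x₀, y₀, …, xₙ, yₙ)` to
`f⁽ⁿ⁺¹⁾ (x₀, x₁, …, xₙ, y₀) + ∑ᵢ f⁽ⁿ⁾ (x₀, …, xᵢ₋₁, yᵢ, xᵢ₊₁, …, xₙ)`. -/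
def derivMap {A B : C} (f : ∀ n : ℕ, A ⊗ pow A n ⟶ B) (n : ℕ) :
    (A ⊗ A) ⊗ pow (A ⊗ A) n ⟶ B :=
  let x₀ := var0 (A ⊗ A) n ≫ fst A A
  let y₀ := var0 (A ⊗ A) n ≫ snd A A
  let x := fun i => var (A ⊗ A) n i ≫ fst A A
  let y := fun i => var (A ⊗ A) n i ≫ snd A A
  ap (f (n + 1)) x₀ (Fin.snoc x y₀) + ∑ i, ap (f n) x₀ (Function.update x i (y i))

end Formulas

/-! ### The morphisms given by the formulas are symmetric and multilinear -/

section Closure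

theorem comp_sum {C : Type u} [Category.{v} C] [LeftAdditiveCategory C] {A B E : C} {ι : Type*} (s : Finset ι) (u : A ⟶ B) (f : ι → (B ⟶ E)) :
    u ≫ (∑ i ∈ s, f i) = ∑ i ∈ s, u ≫ f i := by
  classical
  induction s using Finset.induction_on with
  | empty => simp [LeftAdditiveCategory.comp_zero]
  | insert a s ha ih => simp [Finset.sum_insert ha, LeftAdditiveCategory.comp_add, ih]

variable {C : Type u} [Category.{v} C] [CartesianMonoidalCategory C]

/-- Listing the same family of arguments in two ways gives the same value. -/
theorem ap_equiv {A B X : C} (f : ∀ n : ℕ, A ⊗ pow A n ⟶ B) (hf : ∀ n, IsSymmetric (f n))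
    {ι : Type*} {m m' : ℕ} (e : Fin m ≃ ι) (e' : Fin m' ≃ ι) (x : X ⟶ A) (z : ι → (X ⟶ A)) :
    ap (f m) x (fun j => z (e j)) = ap (f m') x (fun j => z (e' j)) := by
  have hm : m = m' := by simpa using Fintype.card_congr (e.trans e'.symm)
  subst hm
  have := hf m x (fun j => z (e' j)) (e.trans e'.symm)
  rw [← this]
  congr 1
  funext j
  simp

theorem ap_subsetMap {A B X : C} (f : ∀ n : ℕ, A ⊗ pow A n ⟶ B) {n : ℕ} (I : Finset (Fin n))
    (x : X ⟶ A) (v : Fin n → (X ⟶ A)) :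
    ap (subsetMap f I) x v = ap (f I.card) x (fun j => v (I.orderEmbOfFin rfl j)) := by
  rw [ap, subsetMap, comp_ap, lift_tuple_var0]
  simp only [lift_tuple_var]

theorem ap_subsetMap_update_of_notMem {A B X : C} (f : ∀ n : ℕ, A ⊗ pow A n ⟶ B) {n : ℕ}
    (I : Finset (Fin n)) (x : X ⟶ A) (v : Fin n → (X ⟶ A)) {i : Fin n} (hi : i ∉ I) (y : X ⟶ A) :
    ap (subsetMap f I) x (Function.update v i y) = ap (subsetMap f I) x v := by
  rw [ap_subsetMap, ap_subsetMap]
  congr 1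
  funext j
  rw [Function.update_of_ne]
  rintro rfl
  exact hi (I.orderEmbOfFin_mem rfl j)

theorem ap_subsetMap_perm {A B X : C} (f : ∀ n : ℕ, A ⊗ pow A n ⟶ B)
    (hf : ∀ n, IsSymmetric (f n)) {n : ℕ} (I : Finset (Fin n)) (σ : Equiv.Perm (Fin n))
    (x : X ⟶ A) (v : Fin n → (X ⟶ A)) :
    ap (subsetMap f I) x (v ∘ σ) = ap (subsetMap f (σ.finsetCongr I)) x v := by
  rw [ap_subsetMap, ap_subsetMap]
  let e : {i // i ∈ I} ≃ {i // i ∈ σ.finsetCongr I} := σ.subtypeEquiv (by simp)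
  exact ap_equiv f hf ((I.orderIsoOfFin rfl).toEquiv.trans e)
    ((σ.finsetCongr I).orderIsoOfFin rfl).toEquiv x (fun i => v i)

theorem ap_subsetMap_empty {A B X : C} (f : ∀ n : ℕ, A ⊗ pow A n ⟶ B) {n : ℕ}
    (x : X ⟶ A) (v : Fin n → (X ⟶ A)) :
    ap (subsetMap f (∅ : Finset (Fin n))) x v = ap (f 0) x Fin.elim0 := by
  rw [ap_subsetMap]
  change ap (f 0) x _ = _
  congr 1
  funext j
  exact j.elim0

theorem ap_partitionTerm {A B E X : C} (f : ∀ n : ℕ, A ⊗ pow A n ⟶ B)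
    (g : ∀ n : ℕ, B ⊗ pow B n ⟶ E) {n : ℕ} (P : Finpartition (Finset.univ : Finset (Fin n)))
    (x : X ⟶ A) (v : Fin n → (X ⟶ A)) :
    ap (partitionTerm f g P) x v = ap (g P.parts.card) (ap (f 0) x Fin.elim0)
      (fun j => ap (subsetMap f (P.parts.equivFin.symm j : Finset (Fin n))) x v) := by
  rw [ap, partitionTerm, comp_ap, ← ap_subsetMap_empty f x v]
  rfl

/-- The image of a partition under a permutation of the indices. -/
def permPartition {n : ℕ} (σ : Equiv.Perm (Fin n))
    (P : Finpartition (Finset.univ : Finset (Fin n))) :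
    Finpartition (Finset.univ : Finset (Fin n)) :=
  (P.map (a := Finset.univ)
    { toEquiv := σ.finsetCongr, map_rel_iff' := by simp : Finset (Fin n) ≃o Finset (Fin n) }).copy
    (by simp)

theorem mem_permPartition {n : ℕ} (σ : Equiv.Perm (Fin n))
    (P : Finpartition (Finset.univ : Finset (Fin n))) (I : Finset (Fin n)) :
    σ.finsetCongr I ∈ (permPartition σ P).parts ↔ I ∈ P.parts := by
  change _ ∈ P.parts.map σ.finsetCongr.toEmbedding ↔ _
  rw [Finset.mem_map_equiv, Equiv.symm_apply_apply]

theorem permPartition_bijective {n : ℕ} (σ : Equiv.Perm (Fin n)) :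
    Function.Bijective (permPartition σ) := by
  apply Finite.injective_iff_bijective.mp
  intro P Q h
  ext I
  rw [← mem_permPartition σ P, h, mem_permPartition]

theorem ap_partitionTerm_perm {A B E X : C} (f : ∀ n : ℕ, A ⊗ pow A n ⟶ B)
    (hf : ∀ n, IsSymmetric (f n)) (g : ∀ n : ℕ, B ⊗ pow B n ⟶ E) (hg : ∀ n, IsSymmetric (g n))
    {n : ℕ} (P : Finpartition (Finset.univ : Finset (Fin n))) (σ : Equiv.Perm (Fin n))
    (x : X ⟶ A) (v : Fin n → (X ⟶ A)) :
    ap (partitionTerm f g P) x (v ∘ σ) = ap (partitionTerm f g (permPartition σ P)) x v := by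
  rw [ap_partitionTerm, ap_partitionTerm]
  simp only [ap_subsetMap_perm f hf]
  let e : {I // I ∈ P.parts} ≃ {I // I ∈ (permPartition σ P).parts} :=
    σ.finsetCongr.subtypeEquiv fun I => (mem_permPartition σ P I).symm
  exact ap_equiv g hg (P.parts.equivFin.symm.trans e) (permPartition σ P).parts.equivFin.symm _
    (fun I => ap (subsetMap f (I : Finset (Fin n))) x v)

variable [LeftAdditiveCategory C]

theorem ap_compMap {A B E X : C} (f : ∀ n : ℕ, A ⊗ pow A n ⟶ B)
    (g : ∀ n : ℕ, B ⊗ pow B n ⟶ E) (n : ℕ) (x : X ⟶ A) (v : Fin n → (X ⟶ A)) :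
    ap (compMap f g n) x v = ∑ P : Finpartition (Finset.univ : Finset (Fin n)),
      ap (partitionTerm f g P) x v := by
  rw [ap, compMap, comp_sum]
  rfl

theorem isSymmetric_compMap {A B E : C} (f : ∀ n : ℕ, A ⊗ pow A n ⟶ B)
    (hf : ∀ n, IsSymmetric (f n)) (g : ∀ n : ℕ, B ⊗ pow B n ⟶ E) (hg : ∀ n, IsSymmetric (g n))
    (n : ℕ) : IsSymmetric (compMap f g n) := by
  intro X x v σ
  rw [ap_compMap, ap_compMap]
  exact Fintype.sum_bijective _ (permPartition_bijective σ) _ _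
    fun P => ap_partitionTerm_perm f hf g hg P σ x v

theorem ap_derivMap {A B X : C} (f : ∀ n : ℕ, A ⊗ pow A n ⟶ B) (n : ℕ) (z : X ⟶ A ⊗ A)
    (w : Fin n → (X ⟶ A ⊗ A)) :
    ap (derivMap f n) z w =
      ap (f (n + 1)) (z ≫ fst A A) (Fin.snoc (fun i => w i ≫ fst A A) (z ≫ snd A A)) +
      ∑ i, ap (f n) (z ≫ fst A A)
        (Function.update (fun j => w j ≫ fst A A) i (w i ≫ snd A A)) := by
  have hs (u : A ⊗ A ⟶ A) (i : Fin n) : lift z (tuple w) ≫ var (A ⊗ A) n i ≫ u = w i ≫ u := by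
    rw [← Category.assoc, lift_tuple_var]
  have h0 (u : A ⊗ A ⟶ A) : lift z (tuple w) ≫ var0 (A ⊗ A) n ≫ u = z ≫ u := by
    rw [← Category.assoc, lift_tuple_var0]
  rw [ap, derivMap, LeftAdditiveCategory.comp_add, comp_sum]
  simp only [comp_ap, h0]
  congr 1
  · congr 1
    funext i
    refine Fin.lastCases ?_ (fun j => ?_) i
    · simp [h0]
    · simp [hs]
  · refine Finset.sum_congr rfl fun i _ => ?_
    congr 1
    funext j
    by_cases h : j = i
    · subst h; simp [hs]
    · simp [h, hs]

theorem isSymmetric_derivMap {A B : C} (f : ∀ n : ℕ, A ⊗ pow A n ⟶ B)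
    (hf : ∀ n, IsSymmetric (f n)) (n : ℕ) : IsSymmetric (derivMap f n) := by
  intro X z w σ
  rw [ap_derivMap, ap_derivMap]
  congr 1
  · let e : Option (Fin n) ≃ Fin (n + 1) := finSuccEquivLast.symm
    have := ap_equiv f hf
      ((finSuccEquivLast (n := n)).trans (Equiv.optionCongr σ)) finSuccEquivLast (z ≫ fst A A)
      (fun o => o.elim (z ≫ snd A A) (fun i => w i ≫ fst A A))
    convert this using 2
    · funext i
      refine Fin.lastCases ?_ (fun j => ?_) i <;> simp
    · funext i
      refine Fin.lastCases ?_ (fun j => ?_) i <;> simp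
  · refine Fintype.sum_equiv σ _ _ fun i => ?_
    rw [← hf n (z ≫ fst A A) (Function.update (fun j => w j ≫ fst A A) (σ i) _) σ]
    congr 1
    funext j
    by_cases h : j = i
    · subst h; simp
    · simp [h]

variable {k : Type w} [CommSemiring k]

theorem isLinearMap_zero {M N : Type*} [AddCommMonoid M] [AddCommMonoid N] [Module k M]
    [Module k N] : IsLinearMap k (fun _ : M => (0 : N)) :=
  ⟨fun _ _ => (add_zero 0).symm, fun c _ => (smul_zero c).symm⟩

theorem isLinearMap_add {M N : Type*} [AddCommMonoid M] [AddCommMonoid N] [Module k M]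
    [Module k N] {f g : M → N} (hf : IsLinearMap k f) (hg : IsLinearMap k g) :
    IsLinearMap k (fun x => f x + g x) :=
  ⟨fun x y => by rw [hf.map_add, hg.map_add, add_add_add_comm],
    fun c x => by rw [hf.map_smul, hg.map_smul, smul_add]⟩

theorem isLinearMap_smul {M N : Type*} [AddCommMonoid M] [AddCommMonoid N] [Module k M]
    [Module k N] {f : M → N} (r : k) (hf : IsLinearMap k f) : IsLinearMap k (fun x => r • f x) :=
  ⟨fun x y => by rw [hf.map_add, smul_add], fun c x => by rw [hf.map_smul, smul_comm]⟩

theorem isLinearMap_comp {M N L : Type*} [AddCommMonoid M] [AddCommMonoid N] [AddCommMonoid L]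
    [Module k M] [Module k N] [Module k L] {f : M → N} {g : N → L} (hg : IsLinearMap k g)
    (hf : IsLinearMap k f) : IsLinearMap k (fun x => g (f x)) :=
  ⟨fun x y => by rw [hf.map_add, hg.map_add], fun c x => by rw [hf.map_smul, hg.map_smul]⟩

theorem isLinearMap_sum {M N ι : Type*} [AddCommMonoid M] [AddCommMonoid N] [Module k M]
    [Module k N] (s : Finset ι) {f : ι → M → N} (hf : ∀ i ∈ s, IsLinearMap k (f i)) :
    IsLinearMap k (fun x => ∑ i ∈ s, f i x) :=
  ⟨fun x y => by
      rw [← Finset.sum_add_distrib]; exact Finset.sum_congr rfl fun i hi => (hf i hi).map_add x y,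
    fun c x => by
      rw [Finset.smul_sum]; exact Finset.sum_congr rfl fun i hi => (hf i hi).map_smul c x⟩

section LeftLinear

variable [LeftLinearCategory k C]

theorem isLinearMap_ap_subsetMap {A B X : C} (f : ∀ n : ℕ, A ⊗ pow A n ⟶ B)
    (hf : ∀ n, IsMultilinear k (f n)) {n : ℕ} (I : Finset (Fin n)) (x : X ⟶ A)
    (v : Fin n → (X ⟶ A)) {i : Fin n} (hi : i ∈ I) :
    IsLinearMap k (fun y : X ⟶ A => ap (subsetMap f I) x (Function.update v i y)) := by
  obtain ⟨a, rfl⟩ : ∃ a, I.orderEmbOfFin rfl a = i := by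
    have : i ∈ Set.range (I.orderEmbOfFin rfl) := by simpa using hi
    exact this
  have := hf I.card x (fun j => v (I.orderEmbOfFin rfl j)) a
  convert this using 2 with y
  rw [ap_subsetMap]
  congr 1
  exact Function.update_comp_eq_of_injective v (I.orderEmbOfFin rfl).injective a y

theorem isMultilinear_partitionTerm {A B E : C} (f : ∀ n : ℕ, A ⊗ pow A n ⟶ B)
    (hf : ∀ n, IsMultilinear k (f n)) (g : ∀ n : ℕ, B ⊗ pow B n ⟶ E)
    (hg : ∀ n, IsMultilinear k (g n)) {n : ℕ}
    (P : Finpartition (Finset.univ : Finset (Fin n))) :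
    IsMultilinear k (partitionTerm f g P) := by
  intro X x v i
  obtain ⟨I, ⟨hI, hiI⟩, huniq⟩ := P.existsUnique_mem (Finset.mem_univ i)
  let a := P.parts.equivFin ⟨I, hI⟩
  have ha : (P.parts.equivFin.symm a : Finset (Fin n)) = I := by simp [a]
  have := isLinearMap_comp
    (hg P.parts.card (ap (f 0) x Fin.elim0)
      (fun j => ap (subsetMap f (P.parts.equivFin.symm j : Finset (Fin n))) x v) a)
    (isLinearMap_ap_subsetMap f hf I x v hiI)
  convert this using 2 with y
  rw [ap_partitionTerm]
  congr 1
  funext j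
  by_cases h : j = a
  · subst h
    rw [Function.update_self, ha]
  · rw [Function.update_of_ne h]
    apply ap_subsetMap_update_of_notMem
    intro hi
    apply h
    have h1 := huniq _ ⟨(P.parts.equivFin.symm j).2, hi⟩
    rw [← ha] at h1
    exact P.parts.equivFin.symm.injective (Subtype.ext h1)

theorem isMultilinear_compMap {A B E : C} (f : ∀ n : ℕ, A ⊗ pow A n ⟶ B)
    (hf : ∀ n, IsMultilinear k (f n)) (g : ∀ n : ℕ, B ⊗ pow B n ⟶ E)
    (hg : ∀ n, IsMultilinear k (g n)) (n : ℕ) : IsMultilinear k (compMap f g n) := by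
  intro X x v i
  simp only [ap_compMap]
  exact isLinearMap_sum _ fun P _ => isMultilinear_partitionTerm f hf g hg P x v i

theorem isSymmetric_add {A B : C} {n : ℕ} {f g : A ⊗ pow A n ⟶ B} (hf : IsSymmetric f)
    (hg : IsSymmetric g) : IsSymmetric (f + g) := by
  intro X x v σ
  have h1 := hf x v σ
  have h2 := hg x v σ
  simp only [ap, LeftAdditiveCategory.comp_add] at *
  rw [h1, h2]

theorem isMultilinear_add {A B : C} {n : ℕ} {f g : A ⊗ pow A n ⟶ B} (hf : IsMultilinear k f)
    (hg : IsMultilinear k g) : IsMultilinear k (f + g) := by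
  intro X x v i
  simp only [ap, LeftAdditiveCategory.comp_add]
  exact isLinearMap_add (hf x v i) (hg x v i)

theorem isSymmetric_smul {A B : C} {n : ℕ} {f : A ⊗ pow A n ⟶ B} (r : k) (hf : IsSymmetric f) :
    IsSymmetric (r • f) := by
  intro X x v σ
  have h1 := hf x v σ
  simp only [ap, LeftLinearCategory.comp_smul] at *
  rw [h1]

theorem isMultilinear_smul {A B : C} {n : ℕ} {f : A ⊗ pow A n ⟶ B} (r : k)
    (hf : IsMultilinear k f) : IsMultilinear k (r • f) := by
  intro X x v i
  simp only [ap, LeftLinearCategory.comp_smul]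
  exact isLinearMap_smul r (hf x v i)

theorem isSymmetric_zero (A B : C) (n : ℕ) : IsSymmetric (0 : A ⊗ pow A n ⟶ B) := by
  intro X x v σ
  simp only [ap, LeftAdditiveCategory.comp_zero]

theorem isMultilinear_zero (A B : C) (n : ℕ) : IsMultilinear k (0 : A ⊗ pow A n ⟶ B) := by
  intro X x v i
  simp only [ap, LeftAdditiveCategory.comp_zero]
  exact isLinearMap_zero

theorem isSymmetric_strictMap {A B : C} (p : A ⟶ B) : ∀ n, IsSymmetric (strictMap p n)
  | 0 => fun x v σ => by rw [Subsingleton.elim (v ∘ σ) v]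
  | 1 => fun x v σ => by rw [Subsingleton.elim σ 1]; rfl
  | _ + 2 => isSymmetric_zero _ _ _

theorem isMultilinear_strictMap {A B : C} (p : A ⟶ B)
    (hp : ∀ X : C, IsLinearMap k (fun h : X ⟶ A => h ≫ p)) :
    ∀ n, IsMultilinear k (strictMap p n)
  | 0 => fun x v i => i.elim0
  | 1 => by
    intro x v i
    convert hp _ using 2 with y
    rw [Subsingleton.elim i 0, ap, strictMap, ← Category.assoc, lift_tuple_var,
      Function.update_self]
  | _ + 2 => isMultilinear_zero _ _ _

end LeftLinear

section CartesianLeftLinear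

variable [CartesianLeftLinearCategory k C]

theorem isLinearMap_comp_fst (X A B : C) :
    IsLinearMap k (fun h : X ⟶ A ⊗ B => h ≫ fst A B) :=
  have h := CartesianLeftLinearCategory.isLinearMap_pair (k := k) X A B
  ⟨fun x y => congrArg Prod.fst (h.map_add x y), fun c x => congrArg Prod.fst (h.map_smul c x)⟩

theorem isLinearMap_comp_snd (X A B : C) :
    IsLinearMap k (fun h : X ⟶ A ⊗ B => h ≫ snd A B) :=
  have h := CartesianLeftLinearCategory.isLinearMap_pair (k := k) X A B
  ⟨fun x y => congrArg Prod.snd (h.map_add x y), fun c x => congrArg Prod.snd (h.map_smul c x)⟩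

theorem isMultilinear_derivMap {A B : C} (f : ∀ n : ℕ, A ⊗ pow A n ⟶ B)
    (hf : ∀ n, IsMultilinear k (f n)) (n : ℕ) : IsMultilinear k (derivMap f n) := by
  intro X z w i
  simp only [ap_derivMap]
  have hupd (y : X ⟶ A ⊗ A) : (fun j => Function.update w i y j ≫ fst A A) =
      Function.update (fun j => w j ≫ fst A A) i (y ≫ fst A A) := by
    funext j
    by_cases h : j = i
    · subst h; simp
    · simp [h]
  apply isLinearMap_add
  · simp only [hupd, Fin.snoc_update]
    have H := hf (n + 1) (z ≫ fst A A)
      (Fin.snoc (fun j => w j ≫ fst A A) (z ≫ snd A A)) i.castSucc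
    exact (isLinearMap_comp H (isLinearMap_comp_fst X A A) :)
  · refine isLinearMap_sum _ fun j _ => ?_
    by_cases h : j = i
    · subst h
      simp only [hupd, Function.update_idem, Function.update_self]
      have H := hf n (z ≫ fst A A) (fun j => w j ≫ fst A A) j
      exact (isLinearMap_comp H (isLinearMap_comp_snd X A A) :)
    · simp only [hupd, Function.update_of_ne h]
      simp only [Function.update_comm (Ne.symm h)]
      have H := hf n (z ≫ fst A A)
        (Function.update (fun j => w j ≫ fst A A) j (w j ≫ snd A A)) i
      exact (isLinearMap_comp H (isLinearMap_comp_fst X A A) :)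

end CartesianLeftLinear

end Closure

/-! ### The Faà di Bruno category -/

section Category

variable {C : Type u} [Category.{v} C] [CartesianMonoidalCategory C] [LeftAdditiveCategory C]
variable (k : Type w) [CommSemiring k] [CartesianLeftLinearCategory k C]

/-- The identity `A ⇝ A`. -/
def Hom.id (A : C) : Hom k A A where
  map := strictMap (𝟙 A)
  symm := isSymmetric_strictMap (𝟙 A)
  linear := isMultilinear_strictMap (𝟙 A) fun X => by
    simpa only [Category.comp_id] using IsLinearMap.mk (fun _ _ => rfl) (fun _ _ => rfl)

/-- The projection `A × B ⇝ A`. -/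
def Hom.fst (A B : C) : Hom k (A ⊗ B) A where
  map := strictMap (CartesianMonoidalCategory.fst A B)
  symm := isSymmetric_strictMap _
  linear := isMultilinear_strictMap _ fun X => isLinearMap_comp_fst X A B

/-- The projection `A × B ⇝ B`. -/
def Hom.snd (A B : C) : Hom k (A ⊗ B) B where
  map := strictMap (CartesianMonoidalCategory.snd A B)
  symm := isSymmetric_strictMap _
  linear := isMultilinear_strictMap _ fun X => isLinearMap_comp_snd X A B

variable {k}

/-- The composite of `f : A ⇝ B` and `g : B ⇝ E`. -/
noncomputable def Hom.comp {A B E : C} (f : Hom k A B) (g : Hom k B E) : Hom k A E where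
  map := compMap f.map g.map
  symm := isSymmetric_compMap f.map f.symm g.map g.symm
  linear := isMultilinear_compMap f.map f.linear g.map g.linear

/-- The zero morphism `A ⇝ B`. -/
def Hom.zero (A B : C) : Hom k A B where
  map _ := 0
  symm := isSymmetric_zero A B
  linear := isMultilinear_zero A B

/-- The componentwise sum. -/
def Hom.add {A B : C} (f g : Hom k A B) : Hom k A B where
  map n := f.map n + g.map n
  symm n := isSymmetric_add (f.symm n) (g.symm n)
  linear n := isMultilinear_add (f.linear n) (g.linear n)

/-- The componentwise scalar multiple. -/
def Hom.smul {A B : C} (r : k) (f : Hom k A B) : Hom k A B where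
  map n := r • f.map n
  symm n := isSymmetric_smul r (f.symm n)
  linear n := isMultilinear_smul r (f.linear n)

/-- The differential `D f : A × A ⇝ B` of `f : A ⇝ B`. -/
def Hom.deriv {A B : C} (f : Hom k A B) : Hom k (A ⊗ A) B where
  map := derivMap f.map
  symm := isSymmetric_derivMap f.map f.symm
  linear := isMultilinear_derivMap f.map f.linear

end Category

end Faa

/-- The type of objects of the Faà di Bruno category of `C`: a copy of the objects of `C`. -/
structure FaaObj (C : Type u) where
  /-- The underlying object of `C`. -/
  as : C

/-- The data of the Faà di Bruno category of `C`. -/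
noncomputable def Faa.data (k : Type w) [CommSemiring k] (C : Type u) [Category.{v} C]
    [CartesianMonoidalCategory C] [LeftAdditiveCategory C] [CartesianLeftLinearCategory k C] :
    CartesianDifferentialData.{w, v, u} k (FaaObj C) where
  Hom A B := Faa.Hom k A.as B.as
  id A := Faa.Hom.id k A.as
  comp f g := f.comp g
  zero A B := Faa.Hom.zero A.as B.as
  add f g := f.add g
  smul r f := f.smul r
  one := ⟨𝟙_ C⟩
  prod A B := ⟨A.as ⊗ B.as⟩
  fst A B := Faa.Hom.fst k A.as B.as
  snd A B := Faa.Hom.snd k A.as B.as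
  D f := f.deriv

/-!
The value `f⁽ⁿ⁾ (x, v₁, …, vₙ)` of a component of a Faà di Bruno morphism on generalised elements
depends only on `x` and the multiset of the `vᵢ`; it is written `f.ev x m`, and these values
determine `f`. All laws are checked on them.

The only combinatorial step is the chain rule `deriv_comp`, `D (g f) = D g ∘ T f`, where
`T f = (f π₀, D f)` is the tangent morphism. The top-order term of `D (g f)` in degree `n` is a sum
over the partitions of `n + 1` indices. Such a partition arises uniquely from a partition `P` of
the first `n` indices, by adding the last index either as a new singleton part or to an existing
part (`extendPartition_bijective`). The first choice gives the terms of `D g ∘ T f` in which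
`D g` raises the order of `g`, the second those in which a factor `D f` raises the order of `f`.
In the remaining terms of `D (g f)` one argument `xᵢ` is replaced by `yᵢ`, and `i` lies in
exactly one part of `P`; these are the remaining terms of `D f` for that part.

The chain rule yields the other laws of composition without any further sum over partitions.
Multilinearity gives `f.ev x (a ::ₘ m) = (D f).ev (x, a) (m × 0)` (`ev_cons`), so an identity
between composites may be proved by induction on the size of the multiset, simultaneously for all
morphisms: in size `0` composition is composition of functions, and the inductive step
differentiates both sides with the chain rule. Associativity follows in this way, since
`T` preserves composition, and so do the formulas for composing on either side with the *strict*
morphism of a linear map `p`, which is `p x₀`, `p x₁`, `0`, `0`, … in degrees `0`, `1`, `2`, `3`, ….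
Identities and projections are strict. The last two laws for `D (D f)`, as well as the linearity
of `D f` in its second argument, compare tuples related by a strict morphism, which by associativity
can be moved onto `D (D f)` or `D f`; there they are identities between explicit sums.
-/

namespace Faa

/-! ### Multisets of values of finite families -/

theorem exists_equiv_of_map_univ_eq {ι κ α : Type*} [Fintype ι] [Fintype κ] (z : ι → α)
    (w : κ → α) (h : Finset.univ.val.map z = Finset.univ.val.map w) :
    ∃ e : ι ≃ κ, ∀ i, w (e i) = z i := by
  classical
  have hc (a : α) : Fintype.card {i // z i = a} = Fintype.card {j // w j = a} := by
    have := congrArg (Multiset.count a) h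
    rw [Multiset.count_map, Multiset.count_map] at this
    simp only [Fintype.card_subtype, Finset.card_def, Finset.filter_val, eq_comm (b := a)]
    exact this
  exact ⟨Equiv.ofFiberEquiv fun a => Fintype.equivOfCardEq (hc a), Equiv.ofFiberEquiv_map _⟩

theorem map_univ_equiv_finset {ι κ α : Type*} [Fintype κ] {s : Finset ι} (e : κ ≃ {i // i ∈ s})
    (z : ι → α) : Finset.univ.val.map (fun j => z (e j)) = s.val.map z := by
  have h1 : (Finset.univ : Finset κ).val.map e = (Finset.univ : Finset {i // i ∈ s}).val :=
    Multiset.map_univ_val_equiv e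
  have h2 : (Finset.univ : Finset {i // i ∈ s}).val.map Subtype.val = s.val :=
    Multiset.attach_map_val s.val
  rw [← h2, ← h1, Multiset.map_map, Multiset.map_map]
  rfl

theorem map_update_eq {ι α : Type*} [DecidableEq ι] (s : Finset ι) {i : ι} (hi : i ∈ s) (v : ι → α)
    (a : α) : s.val.map (Function.update v i a) = a ::ₘ (s.erase i).val.map v := by
  conv_lhs => rw [← Finset.insert_erase hi]
  rw [Finset.insert_val_of_notMem (Finset.notMem_erase i s), Multiset.map_cons,
    Function.update_self]
  congr 1
  refine Multiset.map_congr rfl fun j hj => Function.update_of_ne ?_ _ _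
  exact Finset.ne_of_mem_erase hj

theorem map_cons_snoc {α : Type*} {n : ℕ} (v : Fin n → α) (a : α) :
    (Finset.univ : Finset (Fin (n + 1))).val.map (Fin.snoc v a : Fin (n + 1) → α) =
      a ::ₘ Finset.univ.val.map v := by
  rw [Fin.univ_castSuccEmb, Finset.cons_val, Multiset.map_cons, Fin.snoc_last, Finset.map_val,
    Multiset.map_map]
  simp

theorem exists_eq_map_univ {α : Type*} (m : Multiset α) :
    ∃ (n : ℕ) (v : Fin n → α), m = Finset.univ.val.map v :=
  ⟨_, m.toList.get, by rw [Fin.univ_val_map, List.ofFn_get, Multiset.coe_toList]⟩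

/-! ### Partitions of `Fin (n + 1)` -/

section Combinatorics

variable {n : ℕ}

/-- The embedding of the subsets of `Fin n` into those of `Fin (n + 1)` avoiding the last
element. -/
def castSuccFinset : Finset (Fin n) ↪ Finset (Fin (n + 1)) :=
  ⟨Finset.map Fin.castSuccEmb, Finset.map_injective _⟩

theorem castSucc_mem_castSuccFinset {I : Finset (Fin n)} {i : Fin n} :
    i.castSucc ∈ castSuccFinset I ↔ i ∈ I :=
  Finset.mem_map' Fin.castSuccEmb

theorem last_notMem_castSuccFinset (I : Finset (Fin n)) : Fin.last n ∉ castSuccFinset I := by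
  simp [castSuccFinset]

/-- Add the last element to a partition of `Fin n`: either as a new singleton part, or in
one of the existing parts. -/
def extendPartition (P : Finpartition (Finset.univ : Finset (Fin n))) :
    Option {I // I ∈ P.parts} → Finpartition (Finset.univ : Finset (Fin (n + 1)))
  | none => Finpartition.ofExistsUnique (insert {Fin.last n} (P.parts.map castSuccFinset))
      (fun _ _ => Finset.subset_univ _)
      (by
        intro a _
        refine Fin.lastCases ?_ (fun i => ?_) a
        · refine ⟨{Fin.last n}, by simp, ?_⟩
          rintro J ⟨hJ, hl⟩
          rw [Finset.mem_insert, Finset.mem_map] at hJ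
          rcases hJ with rfl | ⟨I, -, rfl⟩
          · rfl
          · exact absurd hl (last_notMem_castSuccFinset I)
        · obtain ⟨I, ⟨hI, hi⟩, hu⟩ := P.existsUnique_mem (Finset.mem_univ i)
          refine ⟨castSuccFinset I,
            ⟨Finset.mem_insert_of_mem (Finset.mem_map_of_mem _ hI),
              castSucc_mem_castSuccFinset.2 hi⟩, ?_⟩
          rintro J ⟨hJ, hl⟩
          rw [Finset.mem_insert, Finset.mem_map] at hJ
          rcases hJ with rfl | ⟨K, hK, rfl⟩
          · exact absurd (Finset.mem_singleton.1 hl) (Fin.castSucc_ne_last i)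
          · rw [hu K ⟨hK, castSucc_mem_castSuccFinset.1 hl⟩])
      (by
        rw [Finset.mem_insert, Finset.mem_map]
        rintro (h | ⟨I, hI, h⟩)
        · exact Finset.singleton_ne_empty _ h.symm
        · exact P.ne_empty hI (Finset.map_eq_empty.1 h))
  | some I => Finpartition.ofExistsUnique
      (insert (insert (Fin.last n) (castSuccFinset I)) ((P.parts.erase I).map castSuccFinset))
      (fun _ _ => Finset.subset_univ _)
      (by
        intro a _
        refine Fin.lastCases ?_ (fun i => ?_) a
        · refine ⟨_, ⟨Finset.mem_insert_self _ _, Finset.mem_insert_self _ _⟩, ?_⟩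
          rintro J ⟨hJ, hl⟩
          rw [Finset.mem_insert, Finset.mem_map] at hJ
          rcases hJ with rfl | ⟨K, -, rfl⟩
          · rfl
          · exact absurd hl (last_notMem_castSuccFinset K)
        · obtain ⟨K, ⟨hK, hi⟩, hu⟩ := P.existsUnique_mem (Finset.mem_univ i)
          by_cases hKI : K = I
          · refine ⟨_, ⟨Finset.mem_insert_self _ _, Finset.mem_insert_of_mem
              (castSucc_mem_castSuccFinset.2 (hKI ▸ hi))⟩, ?_⟩
            rintro J ⟨hJ, hl⟩
            rw [Finset.mem_insert, Finset.mem_map] at hJ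
            rcases hJ with rfl | ⟨L, hL, rfl⟩
            · rfl
            · rw [Finset.mem_erase] at hL
              exact absurd ((hu L ⟨hL.2, castSucc_mem_castSuccFinset.1 hl⟩).trans hKI) hL.1
          · refine ⟨castSuccFinset K, ⟨Finset.mem_insert_of_mem (Finset.mem_map_of_mem _
              (Finset.mem_erase.2 ⟨hKI, hK⟩)), castSucc_mem_castSuccFinset.2 hi⟩, ?_⟩
            rintro J ⟨hJ, hl⟩
            rw [Finset.mem_insert, Finset.mem_map] at hJ
            rcases hJ with rfl | ⟨L, hL, rfl⟩
            · have hl' := (Finset.mem_insert.1 hl).resolve_left (Fin.castSucc_ne_last i)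
              exact absurd (hu I ⟨I.2, castSucc_mem_castSuccFinset.1 hl'⟩).symm hKI
            · rw [hu L ⟨Finset.mem_of_mem_erase hL, castSucc_mem_castSuccFinset.1 hl⟩])
      (by
        rw [Finset.mem_insert, Finset.mem_map]
        rintro (h | ⟨K, hK, h⟩)
        · exact Finset.insert_ne_empty _ _ h.symm
        · exact P.ne_empty (Finset.mem_of_mem_erase hK) (Finset.map_eq_empty.1 h))

/-- The restriction to `Fin n` of a subset of `Fin (n + 1)`. -/
def restrictFinset (J : Finset (Fin (n + 1))) : Finset (Fin n) :=
  Finset.univ.filter fun i => i.castSucc ∈ J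

theorem mem_restrictFinset {J : Finset (Fin (n + 1))} {i : Fin n} :
    i ∈ restrictFinset J ↔ i.castSucc ∈ J := by
  simp [restrictFinset]

theorem restrictFinset_castSuccFinset (I : Finset (Fin n)) :
    restrictFinset (castSuccFinset I) = I := by
  ext i
  rw [mem_restrictFinset, castSucc_mem_castSuccFinset]

theorem restrictFinset_insert_last (J : Finset (Fin (n + 1))) :
    restrictFinset (insert (Fin.last n) J) = restrictFinset J := by
  ext i
  simp [mem_restrictFinset]

theorem castSuccFinset_restrictFinset {J : Finset (Fin (n + 1))} (h : Fin.last n ∉ J) :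
    castSuccFinset (restrictFinset J) = J := by
  ext a
  refine Fin.lastCases ?_ (fun i => ?_) a
  · exact iff_of_false (last_notMem_castSuccFinset _) h
  · rw [castSucc_mem_castSuccFinset, mem_restrictFinset]

theorem insert_last_castSuccFinset_restrictFinset {J : Finset (Fin (n + 1))} (h : Fin.last n ∈ J) :
    insert (Fin.last n) (castSuccFinset (restrictFinset J)) = J := by
  ext a
  refine Fin.lastCases ?_ (fun i => ?_) a
  · simp [h]
  · simp [castSucc_mem_castSuccFinset, mem_restrictFinset]

/-- The partition of `Fin n` into the nonempty restrictions of the parts of a partition of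
`Fin (n + 1)`. -/
def restrictPartition (Q : Finpartition (Finset.univ : Finset (Fin (n + 1)))) :
    Finpartition (Finset.univ : Finset (Fin n)) :=
  Finpartition.ofExistsUnique ((Q.parts.image restrictFinset).erase ∅)
    (fun _ _ => Finset.subset_univ _)
    (by
      intro i _
      obtain ⟨J, ⟨hJ, hi⟩, hu⟩ := Q.existsUnique_mem (Finset.mem_univ i.castSucc)
      refine ⟨restrictFinset J, ⟨Finset.mem_erase.2
        ⟨Finset.ne_empty_of_mem (mem_restrictFinset.2 hi), Finset.mem_image_of_mem _ hJ⟩,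
        mem_restrictFinset.2 hi⟩, ?_⟩
      rintro K ⟨hK, hiK⟩
      obtain ⟨L, hL, rfl⟩ := Finset.mem_image.1 (Finset.mem_of_mem_erase hK)
      rw [hu L ⟨hL, mem_restrictFinset.1 hiK⟩])
    (Finset.notMem_erase _ _)

theorem mem_restrictPartition {Q : Finpartition (Finset.univ : Finset (Fin (n + 1)))}
    {I : Finset (Fin n)} :
    I ∈ (restrictPartition Q).parts ↔ I ≠ ∅ ∧ ∃ J ∈ Q.parts, restrictFinset J = I := by
  change I ∈ (Q.parts.image restrictFinset).erase ∅ ↔ _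
  rw [Finset.mem_erase, Finset.mem_image]

theorem restrictPartition_extendPartition (P : Finpartition (Finset.univ : Finset (Fin n)))
    (o : Option {I // I ∈ P.parts}) : restrictPartition (extendPartition P o) = P := by
  ext I
  rw [mem_restrictPartition]
  constructor
  · rintro ⟨hI, J, hJ, rfl⟩
    rcases o with _ | ⟨K, hK⟩
    · rcases Finset.mem_insert.1 hJ with rfl | hJ
      · exact absurd (by ext i; simp [mem_restrictFinset]) hI
      · obtain ⟨L, hL, rfl⟩ := Finset.mem_map.1 hJ
        rwa [restrictFinset_castSuccFinset]
    · rcases Finset.mem_insert.1 hJ with rfl | hJ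
      · rwa [restrictFinset_insert_last, restrictFinset_castSuccFinset]
      · obtain ⟨L, hL, rfl⟩ := Finset.mem_map.1 hJ
        rw [restrictFinset_castSuccFinset]
        exact Finset.mem_of_mem_erase hL
  · intro hI
    refine ⟨P.ne_empty hI, ?_⟩
    rcases o with _ | ⟨K, hK⟩
    · exact ⟨_, Finset.mem_insert_of_mem (Finset.mem_map_of_mem _ hI),
        restrictFinset_castSuccFinset I⟩
    · by_cases h : I = K
      · subst h
        exact ⟨_, Finset.mem_insert_self _ _, by
          rw [restrictFinset_insert_last, restrictFinset_castSuccFinset]⟩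
      · exact ⟨_, Finset.mem_insert_of_mem (Finset.mem_map_of_mem _ (Finset.mem_erase.2 ⟨h, hI⟩)),
          restrictFinset_castSuccFinset I⟩

theorem part_extendPartition (P : Finpartition (Finset.univ : Finset (Fin n)))
    (o : Option {I // I ∈ P.parts}) : (extendPartition P o).part (Fin.last n) =
      insert (Fin.last n) (castSuccFinset (o.elim ∅ Subtype.val)) := by
  apply Finpartition.part_eq_of_mem
  · rcases o with _ | I
    · exact Finset.mem_insert_self _ _
    · exact Finset.mem_insert_self _ _
  · exact Finset.mem_insert_self _ _

/-- Each partition of `Fin (n + 1)` is the extension of a unique partition of `Fin n` in a unique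
way. -/
theorem extendPartition_bijective : Function.Bijective
    (fun p : Σ P : Finpartition (Finset.univ : Finset (Fin n)), Option {I // I ∈ P.parts} =>
      extendPartition p.1 p.2) := by
  constructor
  · rintro ⟨P, o⟩ ⟨P', o'⟩ h
    dsimp only at h
    have hP : P = P' := by
      rw [← restrictPartition_extendPartition P o, h, restrictPartition_extendPartition]
    subst hP
    have hpart := congrArg restrictFinset (congrArg (fun Q => Q.part (Fin.last n)) h)
    simp only [part_extendPartition, restrictFinset_insert_last,
      restrictFinset_castSuccFinset] at hpart
    rcases o with _ | I <;> rcases o' with _ | I'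
    · rfl
    · exact absurd hpart.symm (P.ne_empty I'.2)
    · exact absurd hpart (P.ne_empty I.2)
    · rw [Subtype.ext hpart]
  · intro Q
    have hl : Fin.last n ∈ Q.part (Fin.last n) := Q.mem_part_self.2 (Finset.mem_univ _)
    have hQ : Q.part (Fin.last n) ∈ Q.parts := Q.part_mem.2 (Finset.mem_univ _)
    -- The restriction of the part of the last element decides how to extend.
    have key (o : Option {I // I ∈ (restrictPartition Q).parts})
        (ho : o.elim ∅ Subtype.val = restrictFinset (Q.part (Fin.last n))) :
        extendPartition (restrictPartition Q) o = Q := by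
      have hins := part_extendPartition (restrictPartition Q) o
      rw [ho, insert_last_castSuccFinset_restrictFinset hl] at hins
      have hsub : (extendPartition (restrictPartition Q) o).parts ⊆ Q.parts := by
        intro J hJ
        by_cases hJl : Fin.last n ∈ J
        · rwa [← Finpartition.part_eq_of_mem _ hJ hJl, hins]
        · have hJ' : restrictFinset J ∈ (restrictPartition Q).parts := by
            have hmem : restrictFinset J ∈
                (restrictPartition (extendPartition (restrictPartition Q) o)).parts := by
              refine mem_restrictPartition.2 ⟨fun h => ?_, J, hJ, rfl⟩
              rw [← castSuccFinset_restrictFinset hJl, h] at hJ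
              exact Finpartition.ne_empty _ hJ rfl
            rwa [restrictPartition_extendPartition] at hmem
          obtain ⟨hne, K, hK, hKJ⟩ := mem_restrictPartition.1 hJ'
          by_cases hKl : Fin.last n ∈ K
          · rw [← Finpartition.part_eq_of_mem _ hK hKl] at hKJ
            obtain ⟨i, hi⟩ := Finset.nonempty_iff_ne_empty.2 hne
            have h1 := Finpartition.part_eq_of_mem _ hJ (mem_restrictFinset.1 hi)
            rw [← hKJ] at hi
            have hmem := (extendPartition (restrictPartition Q) o).part_mem.2
              (Finset.mem_univ (Fin.last n))
            rw [hins] at hmem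
            rw [Finpartition.part_eq_of_mem _ hmem (mem_restrictFinset.1 hi)] at h1
            exact absurd (h1 ▸ hl) hJl
          · rwa [← castSuccFinset_restrictFinset hJl, ← hKJ, castSuccFinset_restrictFinset hKl]
      ext J
      refine ⟨fun h => hsub h, fun hJ => ?_⟩
      obtain ⟨a, ha⟩ := Q.nonempty_of_mem_parts hJ
      obtain ⟨K, hK, haK⟩ :=
        (extendPartition (restrictPartition Q) o).exists_mem (Finset.mem_univ a)
      rwa [Q.eq_of_mem_parts hJ (hsub hK) ha haK]
    by_cases h : restrictFinset (Q.part (Fin.last n)) = ∅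
    · exact ⟨⟨restrictPartition Q, none⟩, key none h.symm⟩
    · exact ⟨⟨restrictPartition Q, some ⟨_, mem_restrictPartition.2 ⟨h, _, hQ, rfl⟩⟩⟩, key _ rfl⟩

theorem sum_finpartition_succ {N : Type*} [AddCommMonoid N]
    (φ : Finset (Finset (Fin (n + 1))) → N) :
    ∑ Q : Finpartition (Finset.univ : Finset (Fin (n + 1))), φ Q.parts =
      ∑ P : Finpartition (Finset.univ : Finset (Fin n)),
        (φ (insert {Fin.last n} (P.parts.map castSuccFinset)) +
          ∑ I ∈ P.parts, φ (insert (insert (Fin.last n) (castSuccFinset I))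
            ((P.parts.erase I).map castSuccFinset))) := by
  rw [← extendPartition_bijective.sum_comp, Fintype.sum_sigma]
  refine Finset.sum_congr rfl fun P _ => ?_
  rw [Fintype.sum_option, ← Finset.sum_coe_sort P.parts]
  rfl

theorem sum_parts_sum {α N : Type*} [DecidableEq α] [AddCommMonoid N] {s : Finset α}
    (P : Finpartition s) (F : α → N) : ∑ I ∈ P.parts, ∑ i ∈ I, F i = ∑ i ∈ s, F i := by
  conv_rhs => rw [← P.biUnion_parts]
  rw [Finset.sum_biUnion P.disjoint]
  rfl

theorem map_castSuccFinset_snoc {α : Type*} {n : ℕ} (v : Fin n → α) (a : α) (I : Finset (Fin n)) :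
    (castSuccFinset I).val.map (Fin.snoc v a : Fin (n + 1) → α) = I.val.map v := by
  change (I.map Fin.castSuccEmb).val.map _ = _
  rw [Finset.map_val, Multiset.map_map]
  simp

end Combinatorics

/-! ### Generic elements -/

section Evaluation

variable {C : Type u} [Category.{v} C] [CartesianMonoidalCategory C]

theorem tuple_comp_proj {A X : C} {n : ℕ} (h : X ⟶ pow A n) :
    tuple (fun i => h ≫ proj A i) = h := by
  induction n with
  | zero => exact toUnit_unique _ _
  | succ n ih =>
    refine hom_ext _ _ (lift_fst _ _) ((lift_snd _ _).trans ?_)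
    exact (congrArg tuple (funext fun j => (Category.assoc (Z := A) h _ (proj A j)).symm)).trans
      (ih _)

theorem ap_var {A B : C} {n : ℕ} (f : A ⊗ pow A n ⟶ B) : ap f (var0 A n) (var A n) = f := by
  have : tuple (var A n) = snd A (pow A n) := tuple_comp_proj _
  rw [ap, this, var0, lift_fst_snd, Category.id_comp]

theorem ap_ap_var {A' A B X : C} (p : A' ⟶ A) {n : ℕ} (f : A ⊗ pow A n ⟶ B) (x : X ⟶ A')
    (v : Fin n → (X ⟶ A')) : ap (ap f (var0 A' n ≫ p) (fun i => var A' n i ≫ p)) x v =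
      ap f (x ≫ p) (fun i => v i ≫ p) := by
  refine (comp_ap _ _ _ _).trans ?_
  simp only [← Category.assoc, lift_tuple_var0, lift_tuple_var]

variable [LeftAdditiveCategory C] {k : Type w} [CommSemiring k] [CartesianLeftLinearCategory k C]

/-! ### Linear maps -/

variable (k) in
/-- Postcomposition with `p` is `k`-linear, i.e. `p` is a `k`-linear map of the left-linear
category. -/
def IsPostLinear {A B : C} (p : A ⟶ B) : Prop :=
  ∀ X : C, IsLinearMap k (fun h : X ⟶ A => h ≫ p)

theorem isPostLinear_id (A : C) : IsPostLinear k (𝟙 A) := fun X => by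
  simpa only [Category.comp_id] using IsLinearMap.mk (fun _ _ => rfl) (fun _ _ => rfl)

theorem isPostLinear_fst (A B : C) : IsPostLinear k (fst A B) := fun X =>
  isLinearMap_comp_fst X A B

theorem isPostLinear_snd (A B : C) : IsPostLinear k (snd A B) := fun X =>
  isLinearMap_comp_snd X A B

namespace IsPostLinear

theorem comp {A B E : C} {p : A ⟶ B} {q : B ⟶ E} (hp : IsPostLinear k p)
    (hq : IsPostLinear k q) : IsPostLinear k (p ≫ q) := fun X => by
  simpa only [Category.assoc] using isLinearMap_comp (hq X) (hp X)

theorem add {A B : C} {p q : A ⟶ B} (hp : IsPostLinear k p) (hq : IsPostLinear k q) :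
    IsPostLinear k (p + q) := fun X => by
  simpa only [LeftAdditiveCategory.comp_add] using isLinearMap_add (hp X) (hq X)

theorem smul {A B : C} {p : A ⟶ B} (r : k) (hp : IsPostLinear k p) :
    IsPostLinear k (r • p) := fun X => by
  simpa only [LeftLinearCategory.comp_smul] using isLinearMap_smul r (hp X)

theorem zero (A B : C) : IsPostLinear k (0 : A ⟶ B) := fun X => by
  simpa only [LeftAdditiveCategory.comp_zero] using isLinearMap_zero

theorem lift {A B E : C} {p : A ⟶ B} {q : A ⟶ E} (hp : IsPostLinear k p)
    (hq : IsPostLinear k q) : IsPostLinear k (CartesianMonoidalCategory.lift p q) := fun X => by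
  have e1 := isLinearMap_comp_fst (k := k) X B E
  have e2 := isLinearMap_comp_snd (k := k) X B E
  constructor
  · intro a b
    apply CartesianMonoidalCategory.hom_ext
    · rw [e1.map_add]
      simp only [Category.assoc, lift_fst, (hp X).map_add]
    · rw [e2.map_add]
      simp only [Category.assoc, lift_snd, (hq X).map_add]
  · intro c a
    apply CartesianMonoidalCategory.hom_ext
    · rw [e1.map_smul]
      simp only [Category.assoc, lift_fst, (hp X).map_smul]
    · rw [e2.map_smul]
      simp only [Category.assoc, lift_snd, (hq X).map_smul]

end IsPostLinear

/-! ### Values of morphisms on multisets -/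

/-- The value `f⁽ⁿ⁾ (x, v₁, …, vₙ)` for `m = {v₁, …, vₙ}`. The elements of `m` are listed in an
arbitrary order, which is immaterial as `f⁽ⁿ⁾` is symmetric. -/
noncomputable def Hom.ev {A B X : C} (f : Hom k A B) (x : X ⟶ A) (m : Multiset (X ⟶ A)) : X ⟶ B :=
  ap (f.map m.toList.length) x m.toList.get

namespace Hom

theorem ap_eq_ev {A B X : C} (f : Hom k A B) {n : ℕ} (x : X ⟶ A) (v : Fin n → (X ⟶ A)) :
    ap (f.map n) x v = f.ev x (Finset.univ.val.map v) := by
  obtain ⟨e, he⟩ := exists_equiv_of_map_univ_eq v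
    (Finset.univ.val.map v).toList.get
    (by rw [Fin.univ_val_map (List.get _), List.ofFn_get, Multiset.coe_toList])
  have := ap_equiv f.map f.symm e (Equiv.refl _) x (Finset.univ.val.map v).toList.get
  simp only [he] at this
  exact this

theorem ap_equiv_eq_ev {A B X : C} (f : Hom k A B) {ι : Type*} (s : Finset ι) {n : ℕ}
    (e : Fin n ≃ {i // i ∈ s}) (x : X ⟶ A) (z : ι → (X ⟶ A)) :
    ap (f.map n) x (fun j => z (e j)) = f.ev x (s.val.map z) := by
  rw [ap_eq_ev, map_univ_equiv_finset]

theorem ext_ev {A B : C} {f g : Hom k A B}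
    (h : ∀ {X : C} {n : ℕ} (x : X ⟶ A) (v : Fin n → (X ⟶ A)),
      f.ev x (Finset.univ.val.map v) = g.ev x (Finset.univ.val.map v)) : f = g := by
  ext n
  rw [← ap_var (f.map n), ← ap_var (g.map n), ap_eq_ev, ap_eq_ev, h]

theorem isLinearMap_ev {A B X : C} (f : Hom k A B) (x : X ⟶ A) (m : Multiset (X ⟶ A)) :
    IsLinearMap k (fun a => f.ev x (a ::ₘ m)) := by
  have := f.linear (m.toList.length + 1) x (Fin.cons 0 m.toList.get) 0
  convert this using 2 with a
  rw [ap_eq_ev, Fin.update_cons_zero]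
  congr 1
  rw [Fin.univ_val_map, List.ofFn_cons, List.ofFn_get, ← Multiset.cons_coe, Multiset.coe_toList]

theorem ev_add {A B X : C} (f : Hom k A B) (x a b : X ⟶ A) (m : Multiset (X ⟶ A)) :
    f.ev x ((a + b) ::ₘ m) = f.ev x (a ::ₘ m) + f.ev x (b ::ₘ m) :=
  (isLinearMap_ev f x m).map_add a b

theorem ev_smul {A B X : C} (f : Hom k A B) (r : k) (x a : X ⟶ A) (m : Multiset (X ⟶ A)) :
    f.ev x ((r • a) ::ₘ m) = r • f.ev x (a ::ₘ m) :=
  (isLinearMap_ev f x m).map_smul r a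

theorem ev_zero {A B X : C} (f : Hom k A B) (x : X ⟶ A) (m : Multiset (X ⟶ A)) :
    f.ev x (0 ::ₘ m) = 0 :=
  (isLinearMap_ev f x m).map_zero

theorem ev_sum {A B X : C} (f : Hom k A B) {ι : Type*} (s : Finset ι) (x : X ⟶ A)
    (a : ι → (X ⟶ A)) (m : Multiset (X ⟶ A)) :
    f.ev x ((∑ i ∈ s, a i) ::ₘ m) = ∑ i ∈ s, f.ev x (a i ::ₘ m) :=
  map_sum (isLinearMap_ev f x m).mk' a s

theorem add_ev {A B X : C} (f g : Hom k A B) (x : X ⟶ A) (m : Multiset (X ⟶ A)) :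
    (f.add g).ev x m = f.ev x m + g.ev x m :=
  LeftAdditiveCategory.comp_add _ _ _

theorem smul_ev {A B X : C} (r : k) (f : Hom k A B) (x : X ⟶ A) (m : Multiset (X ⟶ A)) :
    (f.smul r).ev x m = r • f.ev x m :=
  LeftLinearCategory.comp_smul _ _ _

theorem zero_ev {A B X : C} (x : X ⟶ A) (m : Multiset (X ⟶ A)) :
    (Hom.zero A B : Hom k A B).ev x m = 0 :=
  LeftAdditiveCategory.comp_zero _ _

/-- The Faà di Bruno formula. -/
theorem comp_ev {A B E X : C} (f : Hom k A B) (g : Hom k B E) {n : ℕ} (x : X ⟶ A)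
    (v : Fin n → (X ⟶ A)) : (f.comp g).ev x (Finset.univ.val.map v) =
      ∑ P : Finpartition (Finset.univ : Finset (Fin n)),
        g.ev (f.ev x 0) (P.parts.val.map fun I => f.ev x (I.val.map v)) := by
  rw [← ap_eq_ev]
  refine (ap_compMap _ _ _ _ _).trans (Finset.sum_congr rfl fun P _ => ?_)
  have h0 : ap (f.map 0) x Fin.elim0 = f.ev x 0 := ap_eq_ev _ _ _
  rw [ap_partitionTerm, h0, ← ap_equiv_eq_ev _ _ P.parts.equivFin.symm]
  congr 1
  funext j
  rw [ap_subsetMap]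
  exact ap_equiv_eq_ev f _ (Finset.orderIsoOfFin _ rfl).toEquiv x v

theorem deriv_ev {A B X : C} (f : Hom k A B) {ι : Type*} [DecidableEq ι] (s : Finset ι)
    (z : X ⟶ A ⊗ A) (w : ι → (X ⟶ A ⊗ A)) :
    f.deriv.ev z (s.val.map w) =
      f.ev (z ≫ CartesianMonoidalCategory.fst A A) ((z ≫ CartesianMonoidalCategory.snd A A) ::ₘ
        s.val.map fun i => w i ≫ CartesianMonoidalCategory.fst A A) +
      ∑ i ∈ s, f.ev (z ≫ CartesianMonoidalCategory.fst A A)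
        ((w i ≫ CartesianMonoidalCategory.snd A A) ::ₘ
          (s.erase i).val.map fun i => w i ≫ CartesianMonoidalCategory.fst A A) := by
  rw [← ap_equiv_eq_ev _ s s.equivFin.symm]
  refine (ap_derivMap _ _ _ _).trans ?_
  congr 1
  · rw [ap_eq_ev, map_cons_snoc, map_univ_equiv_finset s.equivFin.symm
      (fun i => w i ≫ CartesianMonoidalCategory.fst A A)]
  · rw [← Finset.sum_coe_sort s]
    refine Fintype.sum_equiv s.equivFin.symm _ _ fun j => ?_
    rw [← map_update_eq s (s.equivFin.symm j).2, ap_eq_ev,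
      ← map_univ_equiv_finset s.equivFin.symm]
    congr 2
    exact (Function.update_comp_eq_of_injective (fun i => w i ≫ CartesianMonoidalCategory.fst A A)
      (Subtype.val_injective.comp s.equivFin.symm.injective) j
      (w (s.equivFin.symm j) ≫ CartesianMonoidalCategory.snd A A)).symm

theorem comp_ev_zero {A B E X : C} (f : Hom k A B) (g : Hom k B E) (x : X ⟶ A) :
    (f.comp g).ev x 0 = g.ev (f.ev x 0) 0 := by
  refine (comp_ev f g (n := 0) x Fin.elim0).trans ?_
  rw [Finset.sum_eq_single_of_mem (⊥ : Finpartition (Finset.univ : Finset (Fin 0)))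
    (Finset.mem_univ _) fun P _ h =>
      absurd (Subsingleton.elim (α := Finpartition (⊥ : Finset (Fin 0))) P _) h]
  rfl

/-! ### Pairing and precomposition with linear maps -/

/-- The pairing `A ⇝ B × E` of `f : A ⇝ B` and `g : A ⇝ E`. -/
def pair {A B E : C} (f : Hom k A B) (g : Hom k A E) : Hom k A (B ⊗ E) where
  map n := lift (f.map n) (g.map n)
  symm n := fun x v σ => by
    have h1 := f.symm n x v σ
    have h2 := g.symm n x v σ
    simp only [ap, comp_lift] at *
    rw [h1, h2]
  linear n := fun {X} x v i => by
    have h1 := f.linear n x v i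
    have h2 := g.linear n x v i
    simp only [ap, comp_lift] at *
    have e1 := isLinearMap_comp_fst (k := k) X B E
    have e2 := isLinearMap_comp_snd (k := k) X B E
    constructor
    · intro a b
      apply CartesianMonoidalCategory.hom_ext
      · rw [e1.map_add, lift_fst, lift_fst, lift_fst, h1.map_add]
      · rw [e2.map_add, lift_snd, lift_snd, lift_snd, h2.map_add]
    · intro c a
      apply CartesianMonoidalCategory.hom_ext
      · rw [e1.map_smul, lift_fst, lift_fst, h1.map_smul]
      · rw [e2.map_smul, lift_snd, lift_snd, h2.map_smul]

theorem pair_ev {A B E X : C} (f : Hom k A B) (g : Hom k A E) (x : X ⟶ A)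
    (m : Multiset (X ⟶ A)) : (f.pair g).ev x m = lift (f.ev x m) (g.ev x m) :=
  comp_lift _ _ _

theorem comp_pair {A B E F : C} (f : Hom k A B) (g : Hom k B E) (h : Hom k B F) :
    f.comp (g.pair h) = (f.comp g).pair (f.comp h) := by
  refine ext_ev fun {X} n x v => ?_
  simp only [comp_ev, pair_ev]
  apply CartesianMonoidalCategory.hom_ext
  · refine (map_sum (isLinearMap_comp_fst (k := k) X E F).mk' _ _).trans ?_
    simp
  · refine (map_sum (isLinearMap_comp_snd (k := k) X E F).mk' _ _).trans ?_
    simp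

/-- For `p : A' ⟶ A` with `k`-linear postcomposition, the family
`(x₀, …, xₙ) ↦ f⁽ⁿ⁾ (p x₀, …, p xₙ)`. -/
noncomputable def precomp {A' A B : C} (p : A' ⟶ A)
    (hp : IsPostLinear k p) (f : Hom k A B) : Hom k A' B where
  map n := ap (f.map n) (var0 A' n ≫ p) (fun i => var A' n i ≫ p)
  symm n := fun x v σ => by
    rw [ap_ap_var, ap_ap_var]
    exact f.symm n (x ≫ p) (fun i => v i ≫ p) σ
  linear n := fun {X} x v i => by
    have := isLinearMap_comp (f.linear n (x ≫ p) (fun i => v i ≫ p) i) (hp X)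
    convert this using 2 with y
    rw [ap_ap_var]
    congr 1
    funext j
    by_cases h : j = i
    · subst h; simp
    · simp [h]

theorem precomp_ev {A' A B X : C} (p : A' ⟶ A)
    (hp : IsPostLinear k p) (f : Hom k A B)
    (x : X ⟶ A') (m : Multiset (X ⟶ A')) :
    (f.precomp p hp).ev x m = f.ev (x ≫ p) (m.map (· ≫ p)) := by
  obtain ⟨n, v, rfl⟩ := exists_eq_map_univ m
  rw [← ap_eq_ev, Multiset.map_map, Function.comp_def, ← ap_eq_ev]
  exact ap_ap_var p (f.map n) x v

/-! ### The chain rule and associativity -/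

/-- The tangent morphism `(x, y) ↦ (f x, D f (x, y))` of `f : A ⇝ B`. -/
noncomputable def tangent {A B : C} (f : Hom k A B) : Hom k (A ⊗ A) (B ⊗ B) :=
  (f.precomp (CartesianMonoidalCategory.fst A A) (isPostLinear_fst A A)).pair f.deriv

theorem tangent_ev_fst {A B X : C} (f : Hom k A B) (z : X ⟶ A ⊗ A) (m : Multiset (X ⟶ A ⊗ A)) :
    f.tangent.ev z m ≫ CartesianMonoidalCategory.fst B B =
      f.ev (z ≫ CartesianMonoidalCategory.fst A A)
        (m.map (· ≫ CartesianMonoidalCategory.fst A A)) := by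
  rw [tangent, pair_ev, lift_fst, precomp_ev]

theorem tangent_ev_snd {A B X : C} (f : Hom k A B) (z : X ⟶ A ⊗ A) (m : Multiset (X ⟶ A ⊗ A)) :
    f.tangent.ev z m ≫ CartesianMonoidalCategory.snd B B = f.deriv.ev z m := by
  rw [tangent, pair_ev, lift_snd]

theorem deriv_ev_zero {A B X : C} (f : Hom k A B) (z : X ⟶ A ⊗ A) :
    f.deriv.ev z 0 = f.ev (z ≫ CartesianMonoidalCategory.fst A A)
      {z ≫ CartesianMonoidalCategory.snd A A} := by
  refine (deriv_ev f (∅ : Finset (Fin 0)) z Fin.elim0).trans ?_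
  simp

/-- The value of a composite with one more argument `y`: in each partition, `y` forms a new part or
joins an existing one. -/
theorem comp_ev_snoc {A B E X : C} (f : Hom k A B) (g : Hom k B E) {n : ℕ} (x y : X ⟶ A)
    (v : Fin n → (X ⟶ A)) :
    (f.comp g).ev x (y ::ₘ Finset.univ.val.map v) =
      ∑ P : Finpartition (Finset.univ : Finset (Fin n)),
        (g.ev (f.ev x 0) (f.ev x {y} ::ₘ P.parts.val.map fun I => f.ev x (I.val.map v)) +
          ∑ I ∈ P.parts, g.ev (f.ev x 0) (f.ev x (y ::ₘ I.val.map v) ::ₘ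
            (P.parts.erase I).val.map fun I => f.ev x (I.val.map v))) := by
  rw [← map_cons_snoc, comp_ev, sum_finpartition_succ fun S => g.ev (f.ev x 0)
    (S.val.map fun I => f.ev x (I.val.map (Fin.snoc v y : Fin (n + 1) → (X ⟶ A))))]
  refine Finset.sum_congr rfl fun P _ => ?_
  have hmap (S : Finset (Finset (Fin n))) : (S.map castSuccFinset).val.map
      (fun I => f.ev x (I.val.map (Fin.snoc v y : Fin (n + 1) → (X ⟶ A)))) =
        S.val.map fun I => f.ev x (I.val.map v) := by
    rw [Finset.map_val, Multiset.map_map]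
    refine Multiset.map_congr rfl fun I _ => ?_
    exact congrArg (f.ev x) (map_castSuccFinset_snoc v y I)
  have hnot (J : Finset (Fin (n + 1))) (hJ : Fin.last n ∈ J) (S : Finset (Finset (Fin n))) :
      J ∉ S.map castSuccFinset := by
    rw [Finset.mem_map]
    rintro ⟨I, -, rfl⟩
    exact last_notMem_castSuccFinset I hJ
  congr 1
  · rw [Finset.insert_val_of_notMem (hnot _ (Finset.mem_singleton_self _) _), Multiset.map_cons,
      hmap, Finset.singleton_val, Multiset.map_singleton, Fin.snoc_last]
  · refine Finset.sum_congr rfl fun I _ => ?_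
    rw [Finset.insert_val_of_notMem (hnot _ (Finset.mem_insert_self _ _) _), Multiset.map_cons,
      hmap, Finset.insert_val_of_notMem (last_notMem_castSuccFinset I), Multiset.map_cons,
      Fin.snoc_last, map_castSuccFinset_snoc]

/-- Replacing the arguments of a composite one at a time: each index belongs to exactly one part of
a partition. -/
theorem sum_comp_ev_update {A B E X : C} (f : Hom k A B) (g : Hom k B E) {n : ℕ} (x : X ⟶ A)
    (v y : Fin n → (X ⟶ A)) :
    ∑ i, (f.comp g).ev x (y i ::ₘ (Finset.univ.erase i).val.map v) =
      ∑ P : Finpartition (Finset.univ : Finset (Fin n)), ∑ I ∈ P.parts, ∑ i ∈ I,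
        g.ev (f.ev x 0) (f.ev x (y i ::ₘ (I.erase i).val.map v) ::ₘ
            (P.parts.erase I).val.map fun I => f.ev x (I.val.map v)) := by
  simp only [← map_update_eq Finset.univ (Finset.mem_univ _), comp_ev]
  rw [Finset.sum_comm]
  refine Finset.sum_congr rfl fun P _ => ?_
  rw [← sum_parts_sum P]
  refine Finset.sum_congr rfl fun I hI => Finset.sum_congr rfl fun i hi => ?_
  rw [← map_update_eq I hi]
  conv_lhs => rw [← Finset.insert_erase hI]
  rw [Finset.insert_val_of_notMem (Finset.notMem_erase I _), Multiset.map_cons]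
  congr 2
  refine Multiset.map_congr rfl fun J hJ => congrArg _ (Multiset.map_congr rfl fun j hj => ?_)
  refine Function.update_of_ne ?_ _ _
  rintro rfl
  exact Finset.ne_of_mem_erase hJ (P.eq_of_mem_parts (Finset.mem_of_mem_erase hJ) hI hj hi)

/-- The chain rule `D (g f) = D g ∘ T f`. -/
theorem deriv_comp {A B E : C} (f : Hom k A B) (g : Hom k B E) :
    (f.comp g).deriv = f.tangent.comp g.deriv := by
  refine ext_ev fun {X} n z w => ?_
  rw [deriv_ev, comp_ev_snoc, sum_comp_ev_update, comp_ev, ← Finset.sum_add_distrib]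
  refine Finset.sum_congr rfl fun P _ => ?_
  rw [deriv_ev]
  simp only [tangent_ev_fst, tangent_ev_snd, deriv_ev, deriv_ev_zero, Multiset.map_zero,
    Multiset.map_map, ev_add, ev_sum, Finset.sum_add_distrib, Function.comp_def, add_assoc]

theorem tangent_comp {A B E : C} (f : Hom k A B) (g : Hom k B E) :
    (f.comp g).tangent = f.tangent.comp g.tangent := by
  rw [tangent, deriv_comp, tangent.eq_def g, comp_pair]
  congr 1
  refine ext_ev fun {X} n z w => ?_
  simp only [precomp_ev, Multiset.map_map, comp_ev, tangent_ev_fst, Function.comp_def,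
    Multiset.map_zero]

/-- The values of `D f` determine those of `f` in positive degree. This is the inductive step in
proofs by induction on the size of the multiset. -/
theorem ev_cons {A B X : C} (f : Hom k A B) (x a : X ⟶ A) (m : Multiset (X ⟶ A)) :
    f.ev x (a ::ₘ m) = f.deriv.ev (lift x a) (m.map fun b => lift b 0) := by
  obtain ⟨n, v, rfl⟩ := exists_eq_map_univ m
  rw [Multiset.map_map, deriv_ev]
  simp [ev_zero]

/-- The derivatives of the two composites are the two composites of `T f`, `T g` and `D h`, so the
statement for multisets of size `n + 1` reduces to that for size `n` and these morphisms. -/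
theorem comp_assoc_ev {X : C} (n : ℕ) : ∀ {A B E F : C} (f : Hom k A B) (g : Hom k B E)
    (h : Hom k E F) (x : X ⟶ A) (m : Multiset (X ⟶ A)), m.card = n →
    ((f.comp g).comp h).ev x m = (f.comp (g.comp h)).ev x m := by
  induction n with
  | zero =>
    intro A B E F f g h x m hm
    rw [Multiset.card_eq_zero.1 hm]
    simp only [comp_ev_zero]
  | succ n ih =>
    intro A B E F f g h x m hm
    obtain ⟨a, m, rfl, -⟩ := Multiset.card_eq_succ_iff.1 hm
    rw [ev_cons, ev_cons, deriv_comp, deriv_comp, tangent_comp, deriv_comp]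
    exact ih _ _ _ _ _ (by simpa using hm)

theorem comp_assoc {A B E F : C} (f : Hom k A B) (g : Hom k B E) (h : Hom k E F) :
    (f.comp g).comp h = f.comp (g.comp h) :=
  ext_ev fun _ _ => comp_assoc_ev _ _ _ _ _ _ rfl

end Hom
end Evaluation

/-! ### Strict morphisms -/

section Strict
variable {C : Type u} [Category.{v} C] [CartesianMonoidalCategory C]
variable [LeftAdditiveCategory C] {k : Type w} [CommSemiring k] [CartesianLeftLinearCategory k C]

namespace Hom

/-- The strict morphism of a linear map `p`: it is `p x₀` in degree `0`, `p x₁` in degree `1`, and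
zero in all higher degrees. -/
def strict {A B : C} (p : A ⟶ B) (hp : IsPostLinear k p) : Hom k A B where
  map := strictMap p
  symm := isSymmetric_strictMap p
  linear := isMultilinear_strictMap p hp

theorem strict_ev_zero {A B X : C} (p : A ⟶ B) (hp : IsPostLinear k p) (x : X ⟶ A) :
    (strict p hp).ev x 0 = x ≫ p := by
  refine (ap_eq_ev (strict p hp) x Fin.elim0).symm.trans ?_
  refine (Category.assoc _ _ _).symm.trans ?_
  rw [lift_tuple_var0]

theorem strict_ev_singleton {A B X : C} (p : A ⟶ B) (hp : IsPostLinear k p) (x a : X ⟶ A) :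
    (strict p hp).ev x {a} = a ≫ p := by
  refine (ap_eq_ev (strict p hp) (n := 1) x fun _ => a).symm.trans ?_
  refine (Category.assoc _ _ _).symm.trans ?_
  rw [lift_tuple_var]

theorem strict_ev_cons_cons {A B X : C} (p : A ⟶ B) (hp : IsPostLinear k p) (x a b : X ⟶ A)
    (m : Multiset (X ⟶ A)) : (strict p hp).ev x (a ::ₘ b ::ₘ m) = 0 := by
  obtain ⟨n, v, rfl⟩ := exists_eq_map_univ m
  rw [← map_cons_snoc, ← map_cons_snoc, ← ap_eq_ev]
  exact LeftAdditiveCategory.comp_zero _ _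

theorem eq_strict {A B : C} (p : A ⟶ B) (hp : IsPostLinear k p) {f : Hom k A B}
    (h0 : ∀ {X : C} (x : X ⟶ A), f.ev x 0 = x ≫ p)
    (h1 : ∀ {X : C} (x a : X ⟶ A), f.ev x {a} = a ≫ p)
    (h2 : ∀ {X : C} (x a b : X ⟶ A) (m : Multiset (X ⟶ A)), f.ev x (a ::ₘ b ::ₘ m) = 0) :
    f = strict p hp := by
  refine ext_ev fun {X} n x v => ?_
  generalize Finset.univ.val.map v = m
  induction m using Multiset.induction with
  | empty => rw [h0, strict_ev_zero]
  | cons a m _ =>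
    induction m using Multiset.induction with
    | empty => exact (h1 x a).trans (strict_ev_singleton p hp x a).symm
    | cons b m _ => rw [h2, strict_ev_cons_cons]

/-- The formula for `D f` when one of the arguments is singled out. -/
theorem deriv_ev_cons {A B X : C} (f : Hom k A B) {ι : Type*} [DecidableEq ι] (s : Finset ι)
    (z c : X ⟶ A ⊗ A) (w : ι → (X ⟶ A ⊗ A)) :
    f.deriv.ev z (c ::ₘ s.val.map w) =
      f.ev (z ≫ CartesianMonoidalCategory.fst A A) ((z ≫ CartesianMonoidalCategory.snd A A) ::ₘ
        (c ≫ CartesianMonoidalCategory.fst A A) ::ₘ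
          s.val.map fun i => w i ≫ CartesianMonoidalCategory.fst A A) +
      (f.ev (z ≫ CartesianMonoidalCategory.fst A A) ((c ≫ CartesianMonoidalCategory.snd A A) ::ₘ
          s.val.map fun i => w i ≫ CartesianMonoidalCategory.fst A A) +
        ∑ i ∈ s, f.ev (z ≫ CartesianMonoidalCategory.fst A A)
          ((w i ≫ CartesianMonoidalCategory.snd A A) ::ₘ
            (c ≫ CartesianMonoidalCategory.fst A A) ::ₘ
              (s.erase i).val.map fun i => w i ≫ CartesianMonoidalCategory.fst A A)) := by
  -- The family `c, (w i)ᵢ` is indexed by `Option ι`.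
  have hmap {β : Type v} (t : Finset ι) (u : Option ι → β) :
      (Finset.insertNone t).val.map u = u none ::ₘ t.val.map fun i => u (some i) := by
    change (Finset.cons none (t.map Function.Embedding.some) (by simp)).val.map u = _
    rw [Finset.cons_val, Multiset.map_cons, Finset.map_val, Multiset.map_map]
    rfl
  have hnone : (Finset.insertNone s).erase none = s.map Function.Embedding.some :=
    Finset.erase_cons (by simp)
  have hsome (i : ι) : (Finset.insertNone s).erase (some i) = Finset.insertNone (s.erase i) := by
    ext o
    cases o <;> simp
  refine (congrArg _ (hmap s fun o => o.elim c w).symm).trans ?_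
  rw [deriv_ev, Finset.sum_insertNone]
  simp only [hmap, hnone, hsome, Option.elim, Finset.map_val, Multiset.map_map]
  rfl

/-- Strict morphisms are linear: `D p` is `p` applied to the second variable. -/
theorem deriv_strict {A B : C} (p : A ⟶ B) (hp : IsPostLinear k p) :
    (strict p hp).deriv = strict (CartesianMonoidalCategory.snd A A ≫ p)
      ((isPostLinear_snd A A).comp hp) := by
  refine eq_strict _ _ (fun z => ?_) (fun z a => ?_) (fun {X} z a b m => ?_)
  · rw [deriv_ev_zero, strict_ev_singleton, Category.assoc]
  · have := deriv_ev_cons (strict p hp) (∅ : Finset (Fin 0)) z a Fin.elim0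
    refine this.trans ?_
    rw [strict_ev_cons_cons, Finset.sum_empty, zero_add, add_zero, Finset.empty_val,
      Multiset.map_zero, Multiset.cons_zero, strict_ev_singleton, Category.assoc]
  · obtain ⟨n, v, hv⟩ := exists_eq_map_univ (b ::ₘ m)
    have hb : Finset.univ.val.map (fun i => v i ≫ CartesianMonoidalCategory.fst A A) =
        (b ≫ CartesianMonoidalCategory.fst A A) ::ₘ
          m.map (· ≫ CartesianMonoidalCategory.fst A A) := by
      simpa [Function.comp_def] using
        congrArg (Multiset.map (· ≫ CartesianMonoidalCategory.fst A A)) hv.symm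
    rw [hv, deriv_ev_cons, hb]
    simp [strict_ev_cons_cons]

theorem precomp_strict {A' A B : C} (p : A' ⟶ A) (hp : IsPostLinear k p) (q : A ⟶ B)
    (hq : IsPostLinear k q) : (strict q hq).precomp p hp = strict (p ≫ q) (hp.comp hq) :=
  eq_strict _ _ (fun x => by simp [precomp_ev, strict_ev_zero])
    (fun x a => by simp [precomp_ev, strict_ev_singleton])
    (fun x a b m => by simp [precomp_ev, strict_ev_cons_cons])

theorem pair_strict {A B E : C} (p : A ⟶ B) (hp : IsPostLinear k p) (q : A ⟶ E)
    (hq : IsPostLinear k q) :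
    (strict p hp).pair (strict q hq) = strict (lift p q) (hp.lift hq) :=
  eq_strict _ _ (fun x => by simp [pair_ev, strict_ev_zero])
    (fun x a => by simp [pair_ev, strict_ev_singleton])
    (fun x a b m => by
      rw [pair_ev, strict_ev_cons_cons, strict_ev_cons_cons]
      exact CartesianMonoidalCategory.hom_ext _ _
        ((lift_fst _ _).trans (isPostLinear_fst (k := k) B E _).map_zero.symm)
        ((lift_snd _ _).trans (isPostLinear_snd (k := k) B E _).map_zero.symm))

/-- The value of the composite of a strict morphism and `f`, by induction on the size of the
multiset, for all `p` and `f` at once. -/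
theorem strict_comp_ev {X : C} (n : ℕ) : ∀ {A B E : C} (p : A ⟶ B) (hp : IsPostLinear k p)
    (f : Hom k B E) (x : X ⟶ A) (m : Multiset (X ⟶ A)), m.card = n →
    ((strict p hp).comp f).ev x m = f.ev (x ≫ p) (m.map (· ≫ p)) := by
  induction n with
  | zero =>
    intro A B E p hp f x m hm
    rw [Multiset.card_eq_zero.1 hm, comp_ev_zero, strict_ev_zero, Multiset.map_zero]
  | succ n ih =>
    intro A B E p hp f x m hm
    obtain ⟨a, m, rfl, -⟩ := Multiset.card_eq_succ_iff.1 hm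
    rw [ev_cons, deriv_comp, tangent, deriv_strict, precomp_strict, pair_strict,
      ih _ _ _ _ _ (by simpa using hm), Multiset.map_cons, ev_cons f]
    simp [(hp X).map_zero]

theorem strict_comp {A B E : C} (p : A ⟶ B) (hp : IsPostLinear k p) (f : Hom k B E) :
    (strict p hp).comp f = f.precomp p hp :=
  ext_ev fun _ _ => by rw [strict_comp_ev _ _ _ _ _ _ rfl, precomp_ev]

theorem comp_strict_ev_of_card {X : C} (n : ℕ) : ∀ {A B E : C} (f : Hom k A B) (p : B ⟶ E)
    (hp : IsPostLinear k p) (x : X ⟶ A) (m : Multiset (X ⟶ A)), m.card = n →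
    (f.comp (strict p hp)).ev x m = f.ev x m ≫ p := by
  induction n with
  | zero =>
    intro A B E f p hp x m hm
    rw [Multiset.card_eq_zero.1 hm, comp_ev_zero, strict_ev_zero]
  | succ n ih =>
    intro A B E f p hp x m hm
    obtain ⟨a, m, rfl, -⟩ := Multiset.card_eq_succ_iff.1 hm
    rw [ev_cons, deriv_comp, deriv_strict, ih _ _ _ _ _ (by simpa using hm), ← Category.assoc,
      tangent_ev_snd, ev_cons f]

theorem comp_strict_ev {A B E X : C} (f : Hom k A B) (p : B ⟶ E)
    (hp : IsPostLinear k p) (x : X ⟶ A) (m : Multiset (X ⟶ A)) :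
    (f.comp (strict p hp)).ev x m = f.ev x m ≫ p :=
  comp_strict_ev_of_card _ f p hp x m rfl

/-! ### The laws of a cartesian differential category -/

theorem id_comp {A B : C} (f : Hom k A B) : (Hom.id k A).comp f = f := by
  refine (strict_comp (𝟙 A) (isPostLinear_id A) f).trans (ext_ev fun x v => ?_)
  simp [precomp_ev, Function.comp_def]

theorem comp_id {A B : C} (f : Hom k A B) : f.comp (Hom.id k B) = f :=
  ext_ev fun _ _ => (comp_strict_ev f (𝟙 B) (isPostLinear_id B) _ _).trans (Category.comp_id _)

theorem comp_fst_ev {A B E X : C} (f : Hom k A (B ⊗ E)) (x : X ⟶ A) (m : Multiset (X ⟶ A)) :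
    (f.comp (Hom.fst k B E)).ev x m = f.ev x m ≫ CartesianMonoidalCategory.fst B E :=
  comp_strict_ev f _ (isPostLinear_fst B E) x m

theorem comp_snd_ev {A B E X : C} (f : Hom k A (B ⊗ E)) (x : X ⟶ A) (m : Multiset (X ⟶ A)) :
    (f.comp (Hom.snd k B E)).ev x m = f.ev x m ≫ CartesianMonoidalCategory.snd B E :=
  comp_strict_ev f _ (isPostLinear_snd B E) x m

theorem pair_comp_fst {A B E : C} (f : Hom k A B) (g : Hom k A E) :
    (f.pair g).comp (Hom.fst k B E) = f :=
  ext_ev fun x v => by rw [comp_fst_ev, pair_ev, lift_fst]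

theorem pair_comp_snd {A B E : C} (f : Hom k A B) (g : Hom k A E) :
    (f.pair g).comp (Hom.snd k B E) = g :=
  ext_ev fun x v => by rw [comp_snd_ev, pair_ev, lift_snd]

theorem hom_ext_prod {A B E : C} {f g : Hom k A (B ⊗ E)}
    (h1 : f.comp (Hom.fst k B E) = g.comp (Hom.fst k B E))
    (h2 : f.comp (Hom.snd k B E) = g.comp (Hom.snd k B E)) : f = g := by
  refine ext_ev fun x v => CartesianMonoidalCategory.hom_ext _ _ ?_ ?_
  · rw [← comp_fst_ev, h1, comp_fst_ev]
  · rw [← comp_snd_ev, h2, comp_snd_ev]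

theorem eq_of_unit {A : C} (f g : Hom k A (𝟙_ C)) : f = g :=
  Hom.ext (funext fun _ => toUnit_unique _ _)

theorem comp_add {A B E : C} (f : Hom k A B) (g h : Hom k B E) :
    f.comp (g.add h) = (f.comp g).add (f.comp h) :=
  ext_ev fun x v => by simp only [comp_ev, add_ev, Finset.sum_add_distrib]

theorem comp_smul {A B E : C} (f : Hom k A B) (r : k) (g : Hom k B E) :
    f.comp (g.smul r) = (f.comp g).smul r :=
  ext_ev fun x v => by simp only [comp_ev, smul_ev, Finset.smul_sum]

theorem comp_zero {A B : C} (f : Hom k A B) (E : C) :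
    f.comp (Hom.zero B E) = Hom.zero A E :=
  ext_ev fun x v => by simp only [comp_ev, zero_ev, Finset.sum_const_zero]

theorem add_comp_strict {A B E : C} (f g : Hom k A B) (p : B ⟶ E) (hp : IsPostLinear k p) :
    (f.add g).comp (strict p hp) = (f.comp (strict p hp)).add (g.comp (strict p hp)) :=
  ext_ev fun x v => by simp only [comp_strict_ev, add_ev, (hp _).map_add]

theorem smul_comp_strict {A B E : C} (r : k) (f : Hom k A B) (p : B ⟶ E)
    (hp : IsPostLinear k p) :
    (f.smul r).comp (strict p hp) = (f.comp (strict p hp)).smul r :=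
  ext_ev fun x v => by simp only [comp_strict_ev, smul_ev, (hp _).map_smul]

theorem deriv_add {A B : C} (f g : Hom k A B) : (f.add g).deriv = f.deriv.add g.deriv :=
  ext_ev fun x v => by
    simp only [deriv_ev, add_ev, Finset.sum_add_distrib]
    exact add_add_add_comm _ _ _ _

theorem deriv_smul {A B : C} (r : k) (f : Hom k A B) : (f.smul r).deriv = f.deriv.smul r :=
  ext_ev fun x v => by simp only [deriv_ev, smul_ev, smul_add, Finset.smul_sum]

/-- If `h` is `h'` followed by the strict morphism of `q`, then `q` can be moved from `h` to the
second factor of a composite. -/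
theorem comp_eq_of_ev {A A' B : C} {h : Hom k A B} (h' : Hom k A A') (q : A' ⟶ B)
    (hq : IsPostLinear k q)
    (H : ∀ {X : C} (x : X ⟶ A) (m : Multiset (X ⟶ A)), h.ev x m = h'.ev x m ≫ q) {E : C}
    (f : Hom k B E) : h.comp f = h'.comp (f.precomp q hq) := by
  rw [← strict_comp, ← comp_assoc]
  congr 1
  exact ext_ev fun x v => by rw [H, comp_strict_ev]

/-- All three composites are composites with the tuple `((x, v), v')`, followed by the linear maps
to `(x, v + v')`, `(x, v)` and `(x, v')`. -/
theorem pair_add_comp_deriv {A B Z : C} (f : Hom k A B) (x v v' : Hom k Z A) :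
    (x.pair (v.add v')).comp f.deriv =
      ((x.pair v).comp f.deriv).add ((x.pair v').comp f.deriv) := by
  have hff := (isPostLinear_fst (k := k) (A ⊗ A) A).comp (isPostLinear_fst A A)
  have hfs := (isPostLinear_fst (k := k) (A ⊗ A) A).comp (isPostLinear_snd A A)
  have hs := isPostLinear_snd (k := k) (A ⊗ A) A
  rw [comp_eq_of_ev ((x.pair v).pair v') _ (hff.lift (hfs.add hs))
      (by intros; simp [pair_ev, add_ev, LeftAdditiveCategory.comp_add]),
    comp_eq_of_ev (h := x.pair v) ((x.pair v).pair v') _ (isPostLinear_fst _ _)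
      (by intros; simp [pair_ev]),
    comp_eq_of_ev (h := x.pair v') ((x.pair v).pair v') _ (hff.lift hs)
      (by intros; simp [pair_ev]), ← comp_add]
  congr 1
  refine ext_ev fun {X} n z w => ?_
  simp only [add_ev, precomp_ev, Multiset.map_map, deriv_ev, Function.comp_def, Category.assoc,
    lift_fst, lift_snd, LeftAdditiveCategory.comp_add, ev_add, Finset.sum_add_distrib]
  exact add_add_add_comm _ _ _ _

theorem pair_smul_comp_deriv {A B Z : C} (f : Hom k A B) (x : Hom k Z A) (r : k)
    (v : Hom k Z A) : (x.pair (v.smul r)).comp f.deriv = ((x.pair v).comp f.deriv).smul r := by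
  rw [comp_eq_of_ev (x.pair v) _ ((isPostLinear_fst A A).lift ((isPostLinear_snd A A).smul r))
      (by intros; simp [pair_ev, smul_ev, LeftLinearCategory.comp_smul]), ← comp_smul]
  congr 1
  refine ext_ev fun {X} n z w => ?_
  simp only [smul_ev, precomp_ev, Multiset.map_map, deriv_ev, Function.comp_def, Category.assoc,
    lift_fst, lift_snd, LeftLinearCategory.comp_smul, ev_smul, smul_add, Finset.smul_sum]

theorem ev_cons_zero {A B X : C} (f : Hom k A B) (x a : X ⟶ A) (m : Multiset (X ⟶ A)) :
    f.ev x (a ::ₘ 0 ::ₘ m) = 0 := by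
  rw [Multiset.cons_swap, ev_zero]

/-- Both sides are composites with the tuple `(x, r, v)`: the linear maps are
`(x, r, v) ↦ ((x, r), (0, v))` and `(x, r, v) ↦ (x, v)`. -/
theorem deriv_deriv_zero {A B Z : C} (f : Hom k A B) (x r v : Hom k Z A) :
    ((x.pair r).pair ((Hom.zero Z A).pair v)).comp f.deriv.deriv = (x.pair v).comp f.deriv := by
  have hff := (isPostLinear_fst (k := k) (A ⊗ A) A).comp (isPostLinear_fst A A)
  have hs := isPostLinear_snd (k := k) (A ⊗ A) A
  rw [comp_eq_of_ev ((x.pair r).pair v) _ ((isPostLinear_fst _ _).lift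
      ((IsPostLinear.zero _ A).lift hs))
      (by intros; simp [pair_ev, zero_ev, LeftAdditiveCategory.comp_zero]),
    comp_eq_of_ev (h := x.pair v) ((x.pair r).pair v) _ (hff.lift hs)
      (by intros; simp [pair_ev])]
  congr 1
  refine ext_ev fun {X} n z w => ?_
  simp only [precomp_ev, Multiset.map_map, deriv_ev, deriv_ev_cons, Function.comp_def,
    Category.assoc, lift_fst, lift_snd, LeftAdditiveCategory.comp_zero, ev_cons_zero,
    Finset.sum_const_zero, add_zero, zero_add]

/-- The left tuple is the right one followed by the interchange
`((x, s), (r, t)) ↦ ((x, r), (s, t))`, under which `D (D f)` is invariant. -/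
theorem deriv_deriv_symm {A B Z : C} (f : Hom k A B) (x r s : Hom k Z A) :
    ((x.pair r).pair (s.pair (Hom.zero Z A))).comp f.deriv.deriv =
      ((x.pair s).pair (r.pair (Hom.zero Z A))).comp f.deriv.deriv := by
  have hf := isPostLinear_fst (k := k) (A ⊗ A) (A ⊗ A)
  have hs := isPostLinear_snd (k := k) (A ⊗ A) (A ⊗ A)
  have hf' := isPostLinear_fst (k := k) A A
  have hs' := isPostLinear_snd (k := k) A A
  rw [comp_eq_of_ev ((x.pair s).pair (r.pair (Hom.zero Z A))) _
    (((hf.comp hf').lift (hs.comp hf')).lift ((hf.comp hs').lift (hs.comp hs')))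
      (by intros; simp [pair_ev])]
  congr 1
  refine ext_ev fun {X} n z w => ?_
  simp only [precomp_ev, Multiset.map_map, deriv_ev, deriv_ev_cons, Function.comp_def,
    Category.assoc, lift_fst, lift_snd, Finset.sum_add_distrib]
  have hadd {M : Type v} [AddCommMonoid M] (a t S S' T D : M) :
      a + (t + S) + (S' + (T + D)) = a + (t + S') + (S + (T + D)) := by abel
  refine (hadd _ _ _ _ _ _).trans (congrArg₂ (· + ·) (congrArg₂ (· + ·) ?_ (congrArg₂ (· + ·) rfl
    ?_)) (congrArg₂ (· + ·) ?_ (congrArg₂ (· + ·) rfl ?_)))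
  · rw [Multiset.cons_swap]
  · exact Finset.sum_congr rfl fun i _ => by rw [Multiset.cons_swap]
  · exact Finset.sum_congr rfl fun i _ => by rw [Multiset.cons_swap]
  -- In the double sum the roles of the two distinct indices are exchanged.
  · rw [Finset.sum_comm' (t' := Finset.univ) (s' := fun i => Finset.univ.erase i)
      (by simp [eq_comm])]
    refine Finset.sum_congr rfl fun i _ => Finset.sum_congr rfl fun j _ => ?_
    rw [Multiset.cons_swap, Finset.erase_right_comm]

theorem deriv_fst (A B : C) : (Hom.fst k A B).deriv =
    (Hom.snd k (A ⊗ B) (A ⊗ B)).comp (Hom.fst k A B) :=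
  (deriv_strict _ (isPostLinear_fst A B)).trans
    ((precomp_strict _ (isPostLinear_snd _ _) _ (isPostLinear_fst A B)).symm.trans
      (strict_comp _ (isPostLinear_snd _ _) _).symm)

theorem deriv_snd (A B : C) : (Hom.snd k A B).deriv =
    (Hom.snd k (A ⊗ B) (A ⊗ B)).comp (Hom.snd k A B) :=
  (deriv_strict _ (isPostLinear_snd A B)).trans
    ((precomp_strict _ (isPostLinear_snd _ _) _ (isPostLinear_snd A B)).symm.trans
      (strict_comp _ (isPostLinear_snd _ _) _).symm)

theorem deriv_id (A : C) : (Hom.id k A).deriv = Hom.snd k A A :=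
  (deriv_strict _ (isPostLinear_id A)).trans
    ((precomp_strict _ (isPostLinear_snd _ _) _ (isPostLinear_id A)).symm.trans
      ((strict_comp _ (isPostLinear_snd _ _) _).symm.trans (comp_id _)))

theorem deriv_comp_pair {A B E : C} (f : Hom k A B) (g : Hom k B E) :
    (f.comp g).deriv = (((Hom.fst k A A).comp f).pair f.deriv).comp g.deriv := by
  rw [deriv_comp, tangent, ← strict_comp]
  rfl

instance {A B : C} : Zero (Hom k A B) := ⟨zero A B⟩

instance {A B : C} : Add (Hom k A B) := ⟨add⟩

instance {A B : C} : SMul k (Hom k A B) := ⟨smul⟩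

instance {A B : C} : AddCommMonoid (Hom k A B) where
  add_assoc f g h := Hom.ext (funext fun n => add_assoc (f.map n) (g.map n) (h.map n))
  add_comm f g := Hom.ext (funext fun n => add_comm (f.map n) (g.map n))
  zero_add f := Hom.ext (funext fun n => zero_add (f.map n))
  add_zero f := Hom.ext (funext fun n => add_zero (f.map n))
  nsmul := nsmulRec

instance {A B : C} : Module k (Hom k A B) where
  one_smul f := Hom.ext (funext fun n => one_smul k (f.map n))
  mul_smul r s f := Hom.ext (funext fun n => mul_smul r s (f.map n))
  smul_zero r := Hom.ext (funext fun _ => smul_zero r)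
  smul_add r f g := Hom.ext (funext fun n => smul_add r (f.map n) (g.map n))
  add_smul r s f := Hom.ext (funext fun n => add_smul r s (f.map n))
  zero_smul f := Hom.ext (funext fun n => zero_smul k (f.map n))

end Hom
end Strict

/-! ### The cartesian differential category -/

section Structure
variable (k : Type w) [CommSemiring k] (C : Type u) [Category.{v} C] [CartesianMonoidalCategory C]
variable [LeftAdditiveCategory C] [CartesianLeftLinearCategory k C]

/-- A synonym of `FaaObj C` which records `k`, so that the morphisms can be found from the type of
objects. -/
def FaaCat (k : Type w) [CommSemiring k] (C : Type u) [Category.{v} C] [CartesianMonoidalCategory C]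
    [LeftAdditiveCategory C] [CartesianLeftLinearCategory k C] : Type u :=
  FaaObj C

noncomputable instance category : Category.{v} (FaaCat k C) where
  Hom A B := Hom k A.as B.as
  id A := Hom.id k A.as
  comp f g := f.comp g
  id_comp := Hom.id_comp
  comp_id := Hom.comp_id
  assoc := Hom.comp_assoc

open Limits in
/-- The terminal object of `C` is terminal in the Faà di Bruno category. -/
noncomputable def terminalCone : LimitCone (Functor.empty.{0} (FaaCat k C)) where
  cone := asEmptyCone (FaaObj.mk (𝟙_ C) : FaaCat k C)
  isLimit := IsTerminal.ofUniqueHom (fun A => (Hom.zero A.as (𝟙_ C) : Hom k A.as (𝟙_ C)))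
    fun _ _ => Hom.eq_of_unit _ _

open Limits in
/-- The products of `C` are products in the Faà di Bruno category. -/
noncomputable def productCone (A B : FaaCat k C) : LimitCone (pair A B) where
  cone := BinaryFan.mk (P := (FaaObj.mk (A.as ⊗ B.as) : FaaCat k C)) (Hom.fst k A.as B.as)
    (Hom.snd k A.as B.as)
  isLimit := BinaryFan.IsLimit.mk _ (fun f g => Hom.pair f g) (fun f g => Hom.pair_comp_fst f g)
    (fun f g => Hom.pair_comp_snd f g) fun f g _ hf hg => Hom.hom_ext_prod
      (hf.trans (Hom.pair_comp_fst f g).symm) (hg.trans (Hom.pair_comp_snd f g).symm)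

noncomputable instance cartesianMonoidalCategory : CartesianMonoidalCategory (FaaCat k C) :=
  .ofChosenFiniteProducts (terminalCone k C) (productCone k C)

noncomputable instance leftAdditiveCategory : LeftAdditiveCategory (FaaCat k C) where
  homAddCommMonoid A B := inferInstanceAs (AddCommMonoid (Hom k A.as B.as))
  comp_add f g h := Hom.comp_add f g h
  comp_zero f D := Hom.comp_zero f D.as

noncomputable instance leftLinearCategory : LeftLinearCategory k (FaaCat k C) where
  homModule A B := inferInstanceAs (Module k (Hom k A.as B.as))
  comp_smul f r g := Hom.comp_smul f r g

noncomputable instance cartesianLeftLinearCategory :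
    CartesianLeftLinearCategory k (FaaCat k C) where
  toLeftLinearCategory := leftLinearCategory k C
  isLinearMap_pair _ B D :=
    { map_add := fun f g => Prod.ext
        (Hom.add_comp_strict f g _ (isPostLinear_fst B.as D.as))
        (Hom.add_comp_strict f g _ (isPostLinear_snd B.as D.as))
      map_smul := fun r f => Prod.ext
        (Hom.smul_comp_strict r f _ (isPostLinear_fst B.as D.as))
        (Hom.smul_comp_strict r f _ (isPostLinear_snd B.as D.as)) }

variable {k C} in
theorem lift_eq_pair {Z A B : FaaCat k C} (f : Z ⟶ A) (g : Z ⟶ B) :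
    lift f g = Hom.pair f g :=
  CartesianMonoidalCategory.hom_ext (lift f g) (Hom.pair f g : Hom k Z.as (A.as ⊗ B.as))
    ((lift_fst f g).trans (Hom.pair_comp_fst f g).symm)
    ((lift_snd f g).trans (Hom.pair_comp_snd f g).symm)

noncomputable instance cartesianDifferentialCategory :
    CartesianDifferentialCategory k (FaaCat k C) where
  toCartesianLeftLinearCategory := cartesianLeftLinearCategory k C
  D f := Hom.deriv f
  isLinearMap_D A B :=
    { map_add := fun f g => Hom.deriv_add f g
      map_smul := fun r f => Hom.deriv_smul r f }
  isLinearMap_lift_D f Z x :=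
    { map_add := fun v v' => by
        rw [lift_eq_pair, lift_eq_pair, lift_eq_pair]
        exact Hom.pair_add_comp_deriv f x v v'
      map_smul := fun r v => by
        rw [lift_eq_pair, lift_eq_pair]
        exact Hom.pair_smul_comp_deriv f x r v }
  D_fst A B := Hom.deriv_fst A.as B.as
  D_snd A B := Hom.deriv_snd A.as B.as
  D_id A := Hom.deriv_id A.as
  D_comp f g := (Hom.deriv_comp_pair f g).trans
    (congrArg (fun h => Hom.comp h (Hom.deriv g)) (lift_eq_pair (fst _ _ ≫ f) (Hom.deriv f)).symm)
  D_D_zero f Z x r v := by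
    rw [lift_eq_pair, lift_eq_pair, lift_eq_pair, lift_eq_pair]
    exact Hom.deriv_deriv_zero f x r v
  D_D_symm f Z x r s := by
    rw [lift_eq_pair, lift_eq_pair, lift_eq_pair, lift_eq_pair, lift_eq_pair, lift_eq_pair]
    exact Hom.deriv_deriv_symm f x r s

end Structure
end Faa

/-- The Faà di Bruno category of a cartesian left-`k`-linear category is a cartesian differential
category: there is a cartesian differential category whose underlying data (objects, morphisms,
identities, composition, linear structure, products and differential) are `Faa.data k C`. -/
theorem proposition3 (k : Type w) [CommSemiring k] (C : Type u) [Category.{v} C]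
    [CartesianMonoidalCategory C] [LeftAdditiveCategory C] [CartesianLeftLinearCategory k C] :
    ∃ (_ : Category.{v} (FaaObj C)) (_ : CartesianMonoidalCategory (FaaObj C))
      (_ : LeftAdditiveCategory (FaaObj C)) (_ : CartesianDifferentialCategory k (FaaObj C)),
      CartesianDifferentialCategory.data k (FaaObj C) = Faa.data k C := by
  exact ⟨Faa.category k C, Faa.cartesianMonoidalCategory k C, Faa.leftAdditiveCategory k C,
    Faa.cartesianDifferentialCategory k C, rfl⟩
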